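/- Throughout, $\Bbbk$ is an algebraically closed field of characteristic $p>0$. For integers $n,N\ge 0$ let $\mathbb G(n,\mathbb P^N)$ be the Grassmann variety of $n$-planes in $\mathbb P^N$ over $\Bbbk$. For an $n$-dimensional closed subvariety (irreducible and reduced) $X\subset\mathbb P^N$, the Gauss map $\gamma_X:X\dashrightarrow\mathbb G(n,\mathbb P^N)$ is the rational map that sends each smooth point $x\in X$ to the embedded tangent space $\mathbb T_xX\subset\mathbb P^N$ to $X$ at $x$. We write $K(\cdot)$ for the field of rational functions, and $\overline{\gamma_X(X)}$ for the Zariski closure of the image of the smooth points of $X$. **Theorem 1.1.** Let $Y\subset\mathbb G(n,\mathbb P^N)$ be a projective subvariety with $1\le\dim Y\le n$. (1) Let $L/K(Y)$ be a field extension such that $L$ is finitely generated as a field over $\Bbbk$, $\operatorname{tr.deg}_{\Bbbk}L=n$, and the natural $L$-linear map $$\delta_{L/K(Y)}:\Omega_{K(Y)/\Bbbk}\otimes_{K(Y)}L\to\Omega_{L/\Bbbk}$$ is zero. Then there is an $n$-dimensional closed subvariety $X\subset\mathbb P^N$ such that $\overline{\gamma_X(X)}=Y$ and such that the extension $K(X)/K(Y)$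 induced by $\gamma_X$ is the given one: there is an isomorphism $K(X)\cong L$ over $\Bbbk$ under which the pull-back $\gamma_X^*:K(Y)\to K(X)$, $f\mapsto f\circ\gamma_X$, becomes the inclusion $K(Y)\subset L$. (2) In particular, $Y$ is the closure of the image of the Gauss map of some $n$-dimensional closed subvariety $X\subset\mathbb P^N$, and there are infinitely many such $X$. -/

import Mathlib

open MvPolynomial
open scoped LinearAlgebra.Projectivization

attribute [local instance] MvPolynomial.gradedAlgebra

universe u v

/-- A closed subvariety of the projective space with homogeneous coordinates `Z_i` (`i : σ`) over
an algebraically closed field `k`, given by its homogeneous prime ideal in `k[Z_i | i : σ]` (a prime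
that does not contain the irrelevant ideal); that is, by its generic point in
`Proj k[Z_i | i : σ]`. -/
abbrev ProjVariety (k : Type u) [Field k] (σ : Type) : Type u :=
  ProjectiveSpectrum (homogeneousSubmodule σ k)

namespace ProjVariety

variable {k : Type u} [Field k] {σ : Type}

/-- The homogeneous prime ideal `I(X)`. -/
noncomputable abbrev ideal (X : ProjVariety k σ) : Ideal (MvPolynomial σ k) :=
  X.asHomogeneousIdeal.toIdeal

/-- The (closed) points of `X`, as a subset of the projective space of lines in `k^σ`. -/
def points (X : ProjVariety k σ) : Set (ℙ k (σ → k)) :=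
  {x | ∀ F ∈ X.ideal, eval x.rep F = 0}

/-- The local ring of the projective space at the generic point of `X`: fractions `a / b` of
homogeneous polynomials of the same degree with `b ∉ I(X)`. -/
abbrev GenericLocalRing (X : ProjVariety k σ) : Type u :=
  HomogeneousLocalization.AtPrime (homogeneousSubmodule σ k) X.asHomogeneousIdeal.toIdeal

/-- The function field `K(X)`: the fractions `a / b` of homogeneous polynomials of the same degree
with `b ∉ I(X)`, modulo those with `a ∈ I(X)`. -/
def FunctionField (X : ProjVariety k σ) : Type u :=
  IsLocalRing.ResidueField X.GenericLocalRing

noncomputable instance (X : ProjVariety k σ) : Field X.FunctionField :=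
  inferInstanceAs (Field (IsLocalRing.ResidueField X.GenericLocalRing))

/-- The constants `k` inside `K(X)`. -/
noncomputable instance (X : ProjVariety k σ) : Algebra k X.FunctionField :=
  ((IsLocalRing.residue X.GenericLocalRing).comp
    ((HomogeneousLocalization.fromZeroRingHom (homogeneousSubmodule σ k)
        X.asHomogeneousIdeal.toIdeal.primeCompl).comp
      (algebraMap k (homogeneousSubmodule σ k 0)))).toAlgebra

/-- The rational function on `X` that is represented by `a / b`. -/
noncomputable def fraction (X : ProjVariety k σ) (d : ℕ) (a b : homogeneousSubmodule σ k d)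
    (hb : (b : MvPolynomial σ k) ∉ X.ideal) : X.FunctionField :=
  IsLocalRing.residue X.GenericLocalRing (HomogeneousLocalization.mk ⟨d, a, b, Ideal.mem_primeCompl_iff.2 hb⟩)

/-- The dimension of `X`: the transcendence degree of its function field. -/
noncomputable def dim (X : ProjVariety k σ) : Cardinal.{u} :=
  Algebra.trdeg k X.FunctionField

/-- The rational function `f` on `X` is regular at the point `x` of `X`, with value `c` there:
`f` has a representation `a / b` with `b(x) ≠ 0` and `c = a(x) / b(x)`. -/
def HasValueAt (X : ProjVariety k σ) (f : X.FunctionField) (x : ℙ k (σ → k)) (c : k) : Prop :=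
  x ∈ X.points ∧
    ∃ (d : ℕ) (a b : homogeneousSubmodule σ k d) (hb : (b : MvPolynomial σ k) ∉ X.ideal),
      f = X.fraction d a b hb ∧ eval x.rep (b : MvPolynomial σ k) ≠ 0 ∧
        c = eval x.rep (a : MvPolynomial σ k) / eval x.rep (b : MvPolynomial σ k)

/-- The embedded tangent space of `X` at `x`, as a linear subspace of `k^σ`: the vectors `v` with
`∑ i, (∂F/∂Z_i)(x) v_i = 0` for all `F ∈ I(X)`. -/
def tangentSpace [Fintype σ] (X : ProjVariety k σ) (x : ℙ k (σ → k)) : Submodule k (σ → k) where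
  carrier := {v | ∀ F ∈ X.ideal, ∑ i, eval x.rep (pderiv i F) * v i = 0}
  add_mem' {v w} hv hw F hF := by
    simp [mul_add, Finset.sum_add_distrib, hv F hF, hw F hF]
  zero_mem' F _ := by simp
  smul_mem' c v hv F hF := by
    have h : ∑ i, eval x.rep (pderiv i F) * (c • v) i =
        c * ∑ i, eval x.rep (pderiv i F) * v i := by
      rw [Finset.mul_sum]
      exact Finset.sum_congr rfl fun i _ => by simp only [Pi.smul_apply, smul_eq_mul]; ring
    rw [h, hv F hF, mul_zero]

/-- `x` is a smooth point of `X` (Jacobian criterion): the embedded tangent space is a projective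
space of dimension `dim X`. -/
def IsSmoothAt [Fintype σ] (X : ProjVariety k σ) (x : ℙ k (σ → k)) : Prop :=
  x ∈ X.points ∧ Module.rank k (X.tangentSpace x) = X.dim + 1

end ProjVariety

/-- The closure of a set of points of the projective space in the Zariski topology. -/
def zariskiClosure {k : Type u} [Field k] {σ : Type} (s : Set (ℙ k (σ → k))) :
    Set (ℙ k (σ → k)) :=
  {y | ∀ (d : ℕ), ∀ F ∈ homogeneousSubmodule σ k d,
    (∀ x ∈ s, eval x.rep F = 0) → eval y.rep F = 0}

/-- The index set of the Plücker coordinates on `𝔾(n, ℙ^N)`: the increasing sequences of `n + 1`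
elements of `{0, …, N}`. -/
abbrev PluckerIndex (n N : ℕ) : Type := Fin (n + 1) ↪o Fin (N + 1)

/-- The maximal minors of the matrix with the rows `b 0, …, b n`. -/
def pluckerVector {k : Type u} [Field k] {n N : ℕ} (b : Fin (n + 1) → Fin (N + 1) → k) :
    PluckerIndex n N → k :=
  fun J => Matrix.det (Matrix.of fun i j => b i (J j))

/-- `y` is the Plücker point of the `n`-plane in `ℙ^N` that is given by the linear subspace `W` of
`k^(N+1)` of dimension `n + 1`: its coordinates are the maximal minors of a basis of `W`. -/
def IsPluckerPoint {k : Type u} [Field k] {n N : ℕ} (W : Submodule k (Fin (N + 1) → k))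
    (y : ℙ k (PluckerIndex n N → k)) : Prop :=
  ∃ (b : Module.Basis (Fin (n + 1)) k W) (h : pluckerVector (fun i => (b i : Fin (N + 1) → k)) ≠ 0),
    y = Projectivization.mk k (pluckerVector fun i => (b i : Fin (N + 1) → k)) h

/-- The Grassmann variety `𝔾(n, ℙ^N)` of `n`-planes in `ℙ^N`, in its Plücker embedding. -/
def grassmannian (k : Type u) [Field k] (n N : ℕ) : Set (ℙ k (PluckerIndex n N → k)) :=
  {y | ∃ W : Submodule k (Fin (N + 1) → k), IsPluckerPoint W y}

namespace ProjVariety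

variable {k : Type u} [Field k] {n N : ℕ}

/-- The graph of the Gauss map `γ_X : X ⇢ 𝔾(n, ℙ^N)` on the smooth points of an `n`-dimensional
variety `X ⊆ ℙ^N`: `γ_X` maps a smooth point `x` to the embedded tangent space to `X` at `x`. -/
def GaussMap (X : ProjVariety k (Fin (N + 1))) (x : ℙ k (Fin (N + 1) → k))
    (y : ℙ k (PluckerIndex n N → k)) : Prop :=
  X.IsSmoothAt x ∧ IsPluckerPoint (X.tangentSpace x) y

/-- The image `γ_X(X)` of the smooth points of `X` in `𝔾(n, ℙ^N)`. -/
def gaussImage (n : ℕ) (X : ProjVariety k (Fin (N + 1))) : Set (ℙ k (PluckerIndex n N → k)) :=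
  {y | ∃ x, X.GaussMap x y}

/-- The rational function `g` on `X` is the pull-back `f ∘ γ_X` of the rational function `f` on `Y`
by the Gauss map: `g` and `f ∘ γ_X` are defined and agree on a non-empty open subset `h ≠ 0`
of `X`. -/
def IsGaussPullback (X : ProjVariety k (Fin (N + 1))) (Y : ProjVariety k (PluckerIndex n N))
    (f : Y.FunctionField) (g : X.FunctionField) : Prop :=
  ∃ (d : ℕ), ∃ h ∈ homogeneousSubmodule (Fin (N + 1)) k d, h ∉ X.ideal ∧
    ∀ x ∈ X.points, eval x.rep h ≠ 0 →
      ∃ (y : ℙ k (PluckerIndex n N → k)) (c : k),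
        X.GaussMap x y ∧ Y.HasValueAt f y c ∧ X.HasValueAt g x c

end ProjVariety

/-!
The variety `X` is constructed from its generic point. Over `K(Y)` there is a matrix `A` with `n + 1`
rows, with a unit matrix in some columns `J₀`, whose minors are the Plücker coordinates of the generic
point of `Y` (`ProjVariety.exists_universal_matrix`); its rows span the universal `n`-plane. For
elements `t 0, …, t n` of `L`, one of them equal to `1`, take for `X` the variety with the generic
point `ξ = t * A`, a point of the universal plane. As `Ω[K(Y)⁄k] → Ω[L⁄k]` is zero, `dA = 0` and hence
`dξ = dt * A`. If the differentials of the other `t i` are a basis of `Ω[L⁄k]`, differentiating the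
equations of `X` at `ξ`, together with Euler's formula, shows that the rows of `A` are tangent to `X`
at `ξ` (`ProjVariety.sum_pderiv_mul_eq_zero`), and they span the tangent space since `L` is separable
over `k(t)`. So the Gauss map sends the generic point of `X` to that of `Y`.

These statements about generic points are transferred to closed points by clearing denominators: a
`ProjVariety.GaussChart` consists of forms describing the Gauss map on a non-empty open set, and
`ProjVariety.exists_gaussChart` provides one. The smooth points outside of this open set are mapped to
`Y` as well, because around a smooth point the Plücker coordinates of the tangent space are
polynomials by Cramer's rule (`ProjVariety.GaussChart.gaussImage_subset`).

The coordinates of `ξ` must generate `L`. This is where the choice of `t` matters, and where the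
characteristic enters: an entry `a` of `A` is not constant since `1 ≤ dim Y`, and there are `t i`,
whose differentials form a basis, with `L = k(t, a)` (`exists_adjoin_insert_eq_top`), because
changing `t` by `p`-th powers does not change the differentials. Adding a constant `c` to one `t i`
changes a coordinate `x` of `ξ` into `x + c a`, and by the primitive element theorem
`L = k(t, x + c a)` for some `c` (`exists_adjoin_insert_add_smul_eq_top`).

For the infinitude of the set of all `X`, the construction is applied to fields `L` in which all
elements of `K(Y)` are `p ^ e`-th powers (`exists_extension_forall_exists_pow_eq`). If one `X` arose
from infinitely many `e`, the pull-back to `K(X)` of a non-constant function on `Y`, which is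
determined by `X` (`ProjVariety.IsGaussPullback.unique`), would be a `p ^ e`-th power for all `e`,
which is impossible in a finitely generated extension (`isAlgebraic_of_forall_exists_pow_eq`).
-/

/-! ### Separating transcendence bases and differentials -/

open IntermediateField in
open scoped IntermediateField.algebraAdjoinAdjoin in
/-- If `L` is separable over a purely transcendental extension `k(v i | i)` of `k`, then the
differentials `d (v i)` form a basis of `Ω[L⁄k]`: `L` is formally étale over `k[v i | i]`. -/
theorem exists_basis_kaehlerDifferential {k L ι : Type*} [Field k] [Field L] [Algebra k L]
    {v : ι → L} (hv : AlgebraicIndependent k v)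
    [Algebra.IsSeparable (adjoin k (Set.range v)) L] :
    ∃ b : Module.Basis ι L (KaehlerDifferential k L), ∀ i, b i = KaehlerDifferential.D k L (v i) := by
  let _ : Algebra (MvPolynomial ι k) L := (aeval v).toAlgebra
  have hmap : ∀ x, algebraMap (MvPolynomial ι k) L x = aeval v x := fun _ => rfl
  have : IsScalarTower k (MvPolynomial ι k) L :=
    IsScalarTower.of_algebraMap_eq fun x => by rw [hmap, algebraMap_eq, aeval_C]
  let _ : Algebra (MvPolynomial ι k) (adjoin k (Set.range v)) :=
    ((algebraMap (Algebra.adjoin k (Set.range v)) (adjoin k (Set.range v))).comp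
      (hv.aevalEquiv : MvPolynomial ι k →+* Algebra.adjoin k (Set.range v))).toAlgebra
  let _ : Algebra (MvPolynomial ι k) (Algebra.adjoin k (Set.range v)) :=
    (hv.aevalEquiv : MvPolynomial ι k →+* Algebra.adjoin k (Set.range v)).toAlgebra
  have : IsScalarTower (MvPolynomial ι k) (Algebra.adjoin k (Set.range v))
    (adjoin k (Set.range v)) := IsScalarTower.of_algebraMap_eq fun x => rfl
  have : IsScalarTower (MvPolynomial ι k) (adjoin k (Set.range v)) L :=
    IsScalarTower.of_algebraMap_eq fun x => by
      rw [hmap, ← hv.algebraMap_aevalEquiv]; rfl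
  have : IsFractionRing (Algebra.adjoin k (Set.range v)) (adjoin k (Set.range v)) := inferInstance
  have : Algebra.FormallyEtale (MvPolynomial ι k) (Algebra.adjoin k (Set.range v)) :=
    .of_equiv (A := MvPolynomial ι k)
      { hv.aevalEquiv with commutes' := fun _ => rfl }
  have : Algebra.FormallyEtale (Algebra.adjoin k (Set.range v)) (adjoin k (Set.range v)) :=
    .of_isLocalization (nonZeroDivisors _)
  have : Algebra.FormallyEtale (MvPolynomial ι k) (adjoin k (Set.range v)) :=
    .comp _ (Algebra.adjoin k (Set.range v)) _
  have : Algebra.FormallyEtale (adjoin k (Set.range v)) L := .of_isSeparable _ L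
  have : Algebra.FormallyEtale (MvPolynomial ι k) L := .comp _ (adjoin k (Set.range v)) _
  refine ⟨((KaehlerDifferential.mvPolynomialBasis k ι).baseChange L).map
    (KaehlerDifferential.tensorKaehlerEquivOfFormallyEtale k (MvPolynomial ι k) L), fun i => ?_⟩
  rw [Module.Basis.map_apply, Module.Basis.baseChange_apply,
    KaehlerDifferential.mvPolynomialBasis_apply,
    ← KaehlerDifferential.tensorKaehlerEquivOfFormallyEtale_symm_D_algebraMap,
    LinearEquiv.apply_symm_apply, hmap, aeval_X]

open IntermediateField in
/-- A finitely generated extension `L` of `k` is separable over `k(t i | i)` as soon as the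
differentials `d (t i)` span `Ω[L⁄k]`: it is then unramified over `k(t i | i)`. -/
theorem isSeparable_adjoin_of_span_D_eq_top {k L ι : Type*} [Field k] [Field L] [Algebra k L]
    [Algebra.EssFiniteType k L] (t : ι → L)
    (ht : Submodule.span L (Set.range fun i => KaehlerDifferential.D k L (t i)) = ⊤) :
    Algebra.IsSeparable (adjoin k (Set.range t)) L := by
  have : Algebra.EssFiniteType (adjoin k (Set.range t)) L := .of_comp k _ L
  rw [← Algebra.FormallyUnramified.iff_isSeparable, Algebra.formallyUnramified_iff]
  have hsurj := KaehlerDifferential.map_surjective k (adjoin k (Set.range t)) L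
  have hzero : KaehlerDifferential.map k (adjoin k (Set.range t)) L L = 0 := by
    apply LinearMap.ext_on_range ht
    intro i
    rw [KaehlerDifferential.map_D, LinearMap.zero_apply, Algebra.algebraMap_self, RingHom.id_apply]
    exact (KaehlerDifferential.D (adjoin k (Set.range t)) L).map_algebraMap
      ⟨t i, subset_adjoin k _ ⟨i, rfl⟩⟩
  refine ⟨fun x y => ?_⟩
  obtain ⟨x, rfl⟩ := hsurj x
  obtain ⟨y, rfl⟩ := hsurj y
  simp [hzero]

open IntermediateField in
/-- The pencil form of the primitive element theorem: among the fields `F(x + c y)` with `c` in an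
infinite set of constants, two coincide, and such a field contains `y`. -/
theorem exists_mem_adjoin_add_smul {F E : Type*} [Field F] [Field E] [Algebra F E] {x y : E}
    (hx : IsSeparable F x) (hy : IsSeparable F y) {S : Set F} (hS : S.Infinite) :
    ∃ c ∈ S, y ∈ F⟮x + c • y⟯ := by
  have hsep : Algebra.IsSeparable F (adjoin F {x, y}) := by
    rw [isSeparable_adjoin_iff_isSeparable]
    rintro z (rfl | rfl) <;> assumption
  have : FiniteDimensional F (adjoin F {x, y}) := by
    apply finiteDimensional_adjoin
    rintro z (rfl | rfl)
    exacts [hx.isIntegral, hy.isIntegral]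
  have : Finite (IntermediateField F (adjoin F {x, y})) :=
    Field.finite_intermediateField_of_exists_primitive_element F _
      (Field.exists_primitive_element F _)
  let x' : adjoin F {x, y} := ⟨x, subset_adjoin F _ (by simp)⟩
  let y' : adjoin F {x, y} := ⟨y, subset_adjoin F _ (by simp)⟩
  obtain ⟨c, hc, c', hc', hne, heq⟩ := hS.exists_ne_map_eq_of_mapsTo (t := Set.univ)
    (f := fun c => F⟮x' + c • y'⟯) (fun _ _ => Set.mem_univ _) Set.finite_univ
  refine ⟨c, hc, ?_⟩
  have h1 : x' + c • y' ∈ F⟮x' + c • y'⟯ := mem_adjoin_simple_self F _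
  have h2 : x' + c' • y' ∈ F⟮x' + c • y'⟯ := by
    exact (show F⟮x' + c • y'⟯ = F⟮x' + c' • y'⟯ from heq) ▸ mem_adjoin_simple_self F _
  have h3 : y' ∈ F⟮x' + c • y'⟯ := by
    have h4 := F⟮x' + c • y'⟯.smul_mem (sub_mem h1 h2) (x := (c - c')⁻¹)
    have h5 : (c - c')⁻¹ • (x' + c • y' - (x' + c' • y')) = y' := by
      rw [add_sub_add_left_eq_sub, ← sub_smul, smul_smul, inv_mul_cancel₀ (sub_ne_zero.2 hne),
        one_smul]
    rwa [h5] at h4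
  have h6 : (adjoin F {x, y}).val y' ∈ (F⟮x' + c • y'⟯).map (adjoin F {x, y}).val :=
    ⟨y', h3, rfl⟩
  rw [adjoin_map, Set.image_singleton] at h6
  exact h6

open IntermediateField in
/-- The exchange lemma: an element `a` transcendental over `k` is contained in a transcendence basis
`u` that is obtained from a given one by replacing an element `b` by `a`. -/
theorem exists_isTranscendenceBasis_exchange {k L : Type*} [Field k] [Field L] [Algebra k L]
    {s : Finset L} (hs : IsTranscendenceBasis k ((↑) : s → L)) {a : L} (ha : Transcendental k a) :
    ∃ u : Finset L, a ∈ u ∧ IsTranscendenceBasis k ((↑) : u → L) ∧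
      ∃ b ∈ s, (s : Set L) ⊆ insert b u ∧ (u : Set L) ⊆ insert a (s \ {b}) := by
  classical
  have : Algebra.IsAlgebraic (Algebra.adjoin k (insert a (s : Set L))) L :=
    isAlgebraic_iff_exists_isTranscendenceBasis_subset.2 ⟨s, Set.subset_insert _ _, hs⟩
  obtain ⟨u, hau, hus, hu⟩ := exists_isTranscendenceBasis_between (R := k) {a} (insert a (s : Set L))
    (by simp) (by
      have : AlgebraicIndependent k (fun x : ({a} : Set L) => (x : L)) := by
        rw [algebraicIndependent_unique_type_iff]; exact ha
      exact this)
  lift u to Finset L using (s.finite_toSet.insert a).subset hus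
  have hau : a ∈ u := by simpa using hau
  have hus' : u ⊆ insert a s := by intro x hx; simpa using hus hx
  have hcard : u.card = s.card := by
    have := hu.cardinalMk_eq hs
    simpa using this
  by_cases has : a ∈ s
  · have : u = s := Finset.eq_of_subset_of_card_le (by rwa [Finset.insert_eq_of_mem has] at hus')
      hcard.ge
    subst this
    refine ⟨u, hau, hu, a, has, Set.subset_insert _ _, ?_⟩
    simp
  · have h1 : u.erase a ⊆ s := by
      intro x hx
      rw [Finset.mem_erase] at hx
      exact (Finset.mem_insert.1 (hus' hx.2)).resolve_left hx.1
    have h2 : (s \ u.erase a).card = 1 := by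
      rw [Finset.card_sdiff_of_subset h1, Finset.card_erase_of_mem hau, hcard]
      have : 0 < s.card := by rw [← hcard]; exact Finset.card_pos.2 ⟨a, hau⟩
      omega
    obtain ⟨b, hb⟩ := Finset.card_eq_one.1 h2
    have hb' : b ∈ s \ u.erase a := by rw [hb]; simp
    rw [Finset.mem_sdiff] at hb'
    refine ⟨u, hau, hu, b, hb'.1, fun x hx => ?_, fun x hx => ?_⟩
    · by_cases hxu : x ∈ u
      · exact Or.inr hxu
      · have : x ∈ s \ u.erase a := by
          rw [Finset.mem_sdiff]
          exact ⟨hx, fun h => hxu (Finset.mem_of_mem_erase h)⟩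
        rw [hb, Finset.mem_singleton] at this
        exact Or.inl this
    · by_cases hxa : x = a
      · exact Or.inl hxa
      · have hx2 : x ∈ u.erase a := Finset.mem_erase.2 ⟨hxa, hx⟩
        refine Or.inr ⟨h1 hx2, ?_⟩
        rintro rfl
        exact hb'.2 hx2

open IntermediateField in
/-- In an extension of finite type over `k`, a transcendence basis `u` leaves a finite extension of
`k(u)`, so a fixed power of the characteristic makes all elements separable over `k(u)`. -/
theorem exists_forall_isSeparable_pow {k L : Type*} [Field k] [Field L] [Algebra k L]
    [Algebra.EssFiniteType k L] (p : ℕ) [Fact p.Prime] [CharP k p] {u : Set L}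
    (hu : IsTranscendenceBasis k ((↑) : u → L)) :
    ∃ m : ℕ, ∀ x : L, IsSeparable (adjoin k u) (x ^ p ^ m) := by
  have : Algebra.IsAlgebraic (adjoin k u) L := by
    have := hu.isAlgebraic_field
    rwa [Subtype.range_coe] at this
  have : Algebra.EssFiniteType (adjoin k u) L := .of_comp k _ L
  have : FiniteDimensional (adjoin k u) L := Algebra.finite_of_essFiniteType_of_isAlgebraic
  have : FiniteDimensional (separableClosure (adjoin k u) L) L := inferInstance
  have : CharP (adjoin k u) p := charP_of_injective_algebraMap (algebraMap k _).injective p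
  have : CharP (separableClosure (adjoin k u) L) p :=
    charP_of_injective_algebraMap (algebraMap k _).injective p
  have : ExpChar (separableClosure (adjoin k u) L) p := .prime Fact.out
  have : IsPurelyInseparable.HasExponent (separableClosure (adjoin k u) L) L := inferInstance
  refine ⟨IsPurelyInseparable.exponent (separableClosure (adjoin k u) L) L, fun x => ?_⟩
  obtain ⟨y, hy⟩ := IsPurelyInseparable.exponent_def' (separableClosure (adjoin k u) L) p x
  rw [← hy]
  exact mem_separableClosure_iff.1 y.2

open IntermediateField in
/-- Let `k` be algebraically closed of characteristic `p` and let `a` be a transcendental element of the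
finitely generated extension `L`. Then there are `t i` with `L = k(t, a)` whose differentials form a
basis of `Ω[L⁄k]`. Starting from a separating transcendence basis `s` and a primitive element `w` of
`L` over `k(s)`, one element of `s` is changed by a multiple of a `p`-th power `w ^ p ^ (m + 1)`,
which does not change its differential. -/
theorem exists_adjoin_insert_eq_top {k L ι : Type*} [Field k] [IsAlgClosed k] [Field L]
    [Algebra k L] [Algebra.EssFiniteType k L] (p : ℕ) [Fact p.Prime] [CharP k p] [Fintype ι]
    (hι : Algebra.trdeg k L = Fintype.card ι) {a : L} (ha : Transcendental k a) :
    ∃ (t : ι → L) (b : Module.Basis ι L (KaehlerDifferential k L)),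
      (∀ i, b i = KaehlerDifferential.D k L (t i)) ∧ adjoin k (insert a (Set.range t)) = ⊤ := by
  classical
  obtain ⟨s, hs, hsep⟩ := exists_isTranscendenceBasis_and_isSeparable_of_perfectField k L
  have hfin : FiniteDimensional (adjoin k (s : Set L)) L :=
    have : Algebra.EssFiniteType (adjoin k (s : Set L)) L := .of_comp k _ L
    Algebra.finite_of_essFiniteType_of_isAlgebraic
  obtain ⟨w, hw⟩ := Field.exists_primitive_element (adjoin k (s : Set L)) L
  obtain ⟨u, hau, hu, b, hbs, hsu, hus⟩ := exists_isTranscendenceBasis_exchange hs ha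
  obtain ⟨m, hm⟩ := exists_forall_isSeparable_pow p hu
  have : CharP L p := charP_of_injective_algebraMap (algebraMap k L).injective p
  have : ExpChar L p := .prime Fact.out
  have : ExpChar k p := .prime Fact.out
  have : CharP (adjoin k (s : Set L)) p :=
    charP_of_injective_algebraMap (algebraMap k _).injective p
  have : ExpChar (adjoin k (s : Set L)) p := .prime Fact.out
  have : CharP (adjoin k (u : Set L)) p :=
    charP_of_injective_algebraMap (algebraMap k _).injective p
  have : ExpChar (adjoin k (u : Set L)) p := .prime Fact.out
  let F := adjoin k (u : Set L)
  set w' := w ^ p ^ (m + 1) with hw'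
  -- `c` is chosen of the form `d ^ p ^ m`, so that `b ^ p ^ m + c • w' ^ p ^ m` is a power of
  -- `b + d • w'`
  obtain ⟨_, ⟨d, rfl⟩, hd⟩ := exists_mem_adjoin_add_smul (F := F) (hm b) (hm w')
    (S := Set.range fun d : k => algebraMap k F d ^ p ^ m)
    (Set.infinite_range_of_injective fun x y h => by
      simp only [← map_pow] at h
      exact iterateFrobenius_inj k p m ((algebraMap k F).injective h))
  set b' := b + d • w' with hb'
  have hpow : b ^ p ^ m + (algebraMap k F d ^ p ^ m) • w' ^ p ^ m = b' ^ p ^ m := by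
    rw [hb', add_pow_expChar_pow, Algebra.smul_def, Algebra.smul_def, mul_pow, map_pow]
    rfl
  rw [hpow] at hd
  let t : s → L := fun x => if (x : L) = b then b' else x
  have hDp : ∀ y : L, KaehlerDifferential.D k L (y ^ p) = 0 := fun y => by
    rw [Derivation.leibniz_pow, ← Nat.cast_smul_eq_nsmul L, CharP.cast_eq_zero, zero_smul]
  have hDb' : KaehlerDifferential.D k L b' = KaehlerDifferential.D k L b := by
    rw [hb', map_add, Derivation.map_smul, hw', pow_succ, pow_mul, hDp, smul_zero, add_zero]
  have hDt : ∀ x : s, KaehlerDifferential.D k L (t x) = KaehlerDifferential.D k L x := by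
    intro x
    simp only [t]
    split_ifs with hx
    · rw [hDb', hx]
    · rfl
  have : Algebra.IsSeparable (adjoin k (Set.range ((↑) : s → L))) L := by
    convert! hsep <;> simp
  obtain ⟨B, hB⟩ := exists_basis_kaehlerDifferential hs.1
  -- `k(a, t)` contains `k(u)`, hence `w' ^ p ^ m`, hence `w`
  set M := adjoin k (insert a (Set.range t)) with hM
  have haM : a ∈ M := subset_adjoin k _ (Set.mem_insert _ _)
  have htM : ∀ x, t x ∈ M := fun x => subset_adjoin k _ (Set.mem_insert_of_mem _ ⟨x, rfl⟩)
  have hsM : ∀ x ∈ s, x ≠ b → x ∈ M := fun x hx hxb => by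
    have := htM ⟨x, hx⟩
    simpa only [t, if_neg hxb] using this
  have hbM : b' ∈ M := by
    have := htM ⟨b, hbs⟩
    simpa only [t, if_true] using this
  have huM : F ≤ M := adjoin_le_iff.2 fun x hx => by
    rcases hus hx with rfl | hx
    · exact haM
    · exact hsM x hx.1 hx.2
  have hFM : ∀ x y : L, x ∈ M → y ∈ F⟮x⟯ → y ∈ M := by
    intro x y hx hy
    have : F⟮x⟯ ≤ extendScalars huM := adjoin_le_iff.2 (by simpa using hx)
    exact this hy
  have hwM' : w' ^ p ^ m ∈ M := hFM _ _ (pow_mem hbM _) hd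
  have hsMb : b ∈ M := by
    have h1 : w' ∈ M := by
      have hws : IsSeparable F w' := by
        rw [hw', pow_succ', pow_mul]
        exact hm (w ^ p)
      apply hFM _ _ hwM'
      rw [← adjoin_simple_eq_adjoin_pow_expChar_pow_of_isSeparable F L hws p m]
      exact mem_adjoin_simple_self F _
    have : b = b' - d • w' := by rw [hb']; ring
    rw [this]
    exact sub_mem hbM (M.smul_mem h1)
  have hsM' : adjoin k (s : Set L) ≤ M := adjoin_le_iff.2 fun x hx => by
    by_cases hxb : x = b
    · rwa [hxb]
    · exact hsM x hx hxb
  have hwtop : (adjoin k (s : Set L))⟮w' ^ p ^ m⟯ = ⊤ := by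
    rw [hw', ← pow_mul, ← pow_add]
    rw [← adjoin_simple_eq_adjoin_pow_expChar_pow_of_isSeparable' (adjoin k (s : Set L)) L w p _]
    exact hw
  have hMtop : M = ⊤ := by
    rw [eq_top_iff]
    intro x _
    have : (adjoin k (s : Set L))⟮w' ^ p ^ m⟯ ≤ extendScalars hsM' :=
      adjoin_le_iff.2 (by simpa using hwM')
    rw [hwtop] at this
    exact this (mem_top (x := x))
  have e : ι ≃ s := Fintype.equivOfCardEq (by
    have h1 := hs.cardinalMk_eq_trdeg
    rw [hι, Cardinal.mk_fintype, Nat.cast_inj] at h1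
    exact h1.symm)
  refine ⟨t ∘ e, B.reindex e.symm, fun i => ?_, ?_⟩
  · rw [Module.Basis.reindex_apply, hB, Function.comp_apply, hDt]; rfl
  · rw [EquivLike.range_comp, ← hM, hMtop]

open IntermediateField in
/-- If `L = k(t, a)` is separable over `k(t)`, then `L = k(t, x + c a)` for some constant `c`. -/
theorem exists_adjoin_insert_add_smul_eq_top {k L ι : Type*} [Field k] [Infinite k] [Field L]
    [Algebra k L] {t : ι → L} [Algebra.IsSeparable (adjoin k (Set.range t)) L] {a : L}
    (ht : adjoin k (insert a (Set.range t)) = ⊤) (x : L) :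
    ∃ c : k, adjoin k (insert (x + c • a) (Set.range t)) = ⊤ := by
  let F := adjoin k (Set.range t)
  obtain ⟨_, ⟨c, rfl⟩, hc⟩ := exists_mem_adjoin_add_smul (F := F)
    (Algebra.IsSeparable.isSeparable F x) (Algebra.IsSeparable.isSeparable F a)
    (Set.infinite_range_of_injective (algebraMap k F).injective)
  rw [algebraMap_smul] at hc
  refine ⟨c, ?_⟩
  set M := adjoin k (insert (x + c • a) (Set.range t)) with hM
  have hFM : F ≤ M := adjoin.mono k _ _ (Set.subset_insert _ _)
  have hle : F⟮x + c • a⟯ ≤ extendScalars hFM :=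
    adjoin_le_iff.2 (by simpa using subset_adjoin k _ (Set.mem_insert _ _))
  rw [eq_top_iff, ← ht, adjoin_le_iff, Set.insert_subset_iff]
  exact ⟨hle hc, fun y hy => hFM (subset_adjoin k _ hy)⟩

open IntermediateField in
/-- In a finitely generated extension of a field of characteristic `p`, an element that is a
`p ^ e`-th power for all `e` is algebraic over the ground field. Otherwise it is part of a
transcendence basis `u`, and it is a `p`-th power in `k(u)`, so that its differential vanishes. -/
theorem isAlgebraic_of_forall_exists_pow_eq {k L : Type*} [Field k] [Field L] [Algebra k L]
    [Algebra.EssFiniteType k L] (p : ℕ) [Fact p.Prime] [CharP k p] {g : L}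
    (hg : ∀ e : ℕ, ∃ h : L, h ^ p ^ e = g) : IsAlgebraic k g := by
  by_contra htr
  have : Algebra.IsAlgebraic (Algebra.adjoin k (Set.univ : Set L)) L :=
    ⟨fun x => isAlgebraic_algebraMap (⟨x, Algebra.subset_adjoin trivial⟩ :
      Algebra.adjoin k (Set.univ : Set L))⟩
  obtain ⟨u, hgu, -, hu⟩ := exists_isTranscendenceBasis_between (R := k) {g} Set.univ (by simp) (by
      have : AlgebraicIndependent k (fun x : ({g} : Set L) => (x : L)) := by
        rw [algebraicIndependent_unique_type_iff]; exact htr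
      exact this)
  have hgu : g ∈ u := by simpa using hgu
  obtain ⟨m, hm⟩ := exists_forall_isSeparable_pow p hu
  obtain ⟨h, hh⟩ := hg (m + 1)
  let F := adjoin k u
  have : CharP F p := charP_of_injective_algebraMap (algebraMap k F).injective p
  have : ExpChar F p := .prime Fact.out
  -- `h ^ p ^ m` is separable over `F` and its `p`-th power `g` lies in `F`
  have hz : ∃ z : F, algebraMap F L z = h ^ p ^ m := by
    have h1 := adjoin_simple_eq_adjoin_pow_expChar_of_isSeparable F L (hm h) p
    rw [← pow_mul, ← pow_succ, hh] at h1
    have h2 : F⟮g⟯ = ⊥ := adjoin_simple_eq_bot_iff.2 (mem_bot.2 ⟨⟨g, subset_adjoin k _ hgu⟩, rfl⟩)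
    rw [h2] at h1
    exact mem_bot.1 (h1 ▸ mem_adjoin_simple_self F (h ^ p ^ m))
  obtain ⟨z, hz⟩ := hz
  let v : u → F := fun x => ⟨x, subset_adjoin k _ x.2⟩
  have hv : AlgebraicIndependent k v := by
    have : AlgebraicIndependent k (F.val ∘ v) := hu.1
    exact this.of_comp
  have htop : adjoin k (Set.range v) = ⊤ := by
    apply lift_injective F
    rw [lift_adjoin, lift_top, ← Set.range_comp]
    have : (Subtype.val ∘ v) = ((↑) : u → L) := rfl
    rw [this, Subtype.range_coe]
  have : Algebra.IsSeparable (adjoin k (Set.range v)) F :=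
    ⟨fun x => isSeparable_algebraMap (K := F)
      (⟨x, htop.symm ▸ mem_top⟩ : adjoin k (Set.range v))⟩
  obtain ⟨B, hB⟩ := exists_basis_kaehlerDifferential hv
  apply B.ne_zero ⟨g, hgu⟩
  have hgz : v ⟨g, hgu⟩ = z ^ p := (algebraMap F L).injective (by
    rw [map_pow, hz, ← pow_mul, ← pow_succ, hh]; rfl)
  rw [hB, hgz, Derivation.leibniz_pow, ← Nat.cast_smul_eq_nsmul F, CharP.cast_eq_zero, zero_smul]

/-! ### Homogeneous polynomials -/

/-- The value of a homogeneous polynomial at a multiple of a point. -/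
theorem MvPolynomial.aeval_mul_of_isHomogeneous {k σ A : Type*} [CommSemiring k] [CommSemiring A]
    [Algebra k A] {F : MvPolynomial σ k} {d : ℕ} (hF : F.IsHomogeneous d) (c : A) (x : σ → A) :
    aeval (fun i => c * x i) F = c ^ d * aeval x F := by
  rw [aeval_def, aeval_def, eval₂_eq, eval₂_eq, Finset.mul_sum]
  refine Finset.sum_congr rfl fun m hm => ?_
  have hd : ∑ i ∈ m.support, m i = d := by
    have := hF (mem_support_iff.1 hm)
    rwa [Finsupp.weight_apply, Finsupp.sum, Finset.sum_congr rfl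
      (g := fun i => m i) (fun i _ => by simp)] at this
  rw [← hd]
  simp only [mul_pow, Finset.prod_mul_distrib, Finset.prod_pow_eq_pow_sum]
  ring

theorem MvPolynomial.eval_mul_of_isHomogeneous {k σ : Type*} [CommSemiring k]
    {F : MvPolynomial σ k} {d : ℕ} (hF : F.IsHomogeneous d) (c : k) (x : σ → k) :
    eval (fun i => c * x i) F = c ^ d * eval x F := by
  rw [← aeval_eq_eval, ← aeval_eq_eval]
  exact aeval_mul_of_isHomogeneous hF c x

/-- The homogenization of `G` with respect to the coordinate `X i₀`, of degree `G.totalDegree`. -/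
noncomputable def MvPolynomial.homogenization {k σ : Type*} [CommSemiring k] (i₀ : σ)
    (G : MvPolynomial σ k) : MvPolynomial σ k :=
  ∑ e ∈ Finset.range (G.totalDegree + 1),
    X i₀ ^ (G.totalDegree - e) * homogeneousComponent e G

theorem MvPolynomial.isHomogeneous_homogenization {k σ : Type*} [CommSemiring k] (i₀ : σ)
    (G : MvPolynomial σ k) : (homogenization i₀ G).IsHomogeneous G.totalDegree := by
  refine IsHomogeneous.sum _ _ _ fun e he => ?_
  have h := (isHomogeneous_X_pow (R := k) i₀ (G.totalDegree - e)).mul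
    (homogeneousComponent_isHomogeneous e G)
  rwa [Nat.sub_add_cancel (Nat.lt_succ_iff.1 (Finset.mem_range.1 he))] at h

theorem MvPolynomial.aeval_homogenization {k σ A : Type*} [CommSemiring k] [CommSemiring A]
    [Algebra k A] {i₀ : σ} {x : σ → A} (hx : x i₀ = 1) (G : MvPolynomial σ k) :
    aeval x (homogenization i₀ G) = aeval x G := by
  conv_rhs => rw [← sum_homogeneousComponent G]
  simp only [homogenization, map_sum, map_mul, map_pow, aeval_X, hx, one_pow, one_mul]

theorem MvPolynomial.aeval_pderiv_homogenization {k σ A : Type*} [CommSemiring k] [CommSemiring A]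
    [Algebra k A] {i₀ j : σ} (hj : j ≠ i₀) {x : σ → A} (hx : x i₀ = 1) (G : MvPolynomial σ k) :
    aeval x (pderiv j (homogenization i₀ G)) = aeval x (pderiv j G) := by
  conv_rhs => rw [← sum_homogeneousComponent G]
  simp only [homogenization, map_sum]
  refine Finset.sum_congr rfl fun e _ => ?_
  rw [pderiv_mul, pderiv_pow, pderiv_X_of_ne hj.symm, mul_zero, zero_mul, zero_add, map_mul,
    map_pow, aeval_X, hx, one_pow, one_mul]

/-- The coefficients of a polynomial restricted to the line through `0` and `x` are the values at
`x` of the homogeneous components. -/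
theorem MvPolynomial.coeff_aeval_C_mul_X {k σ A : Type*} [CommSemiring k] [CommSemiring A]
    [Algebra k A] (x : σ → A) (F : MvPolynomial σ k) (d : ℕ) :
    (aeval (fun i => Polynomial.X * Polynomial.C (x i)) F).coeff d =
      aeval x (homogeneousComponent d F) := by
  classical
  have hC : ∀ G : MvPolynomial σ k,
      aeval (fun i => Polynomial.C (x i)) G = Polynomial.C (aeval x G) := fun G => by
    exact (map_aeval x Polynomial.C G).symm
  conv_lhs => rw [← sum_homogeneousComponent F]
  rw [map_sum, Polynomial.finsetSum_coeff]
  simp only [aeval_mul_of_isHomogeneous (homogeneousComponent_isHomogeneous _ F), hC,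
    Polynomial.coeff_X_pow_mul', Polynomial.coeff_C]
  by_cases hd : d ≤ F.totalDegree
  · rw [Finset.sum_eq_single d]
    · simp
    · intro e _ he
      split_ifs with h1 h2
      · omega
      · rfl
      · rfl
    · intro h
      exact absurd (Finset.mem_range.2 (Nat.lt_succ_iff.2 hd)) h
  · rw [homogeneousComponent_eq_zero _ _ (not_le.1 hd), map_zero]
    refine Finset.sum_eq_zero fun e he => ?_
    have := Finset.mem_range.1 he
    split_ifs with h1 h2
    · omega
    · rfl
    · rfl

namespace ProjVariety

/-! ### Points of a projective variety -/

section Points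

variable {k : Type u} [Field k] {σ : Type}

theorem exists_X_notMem (X : ProjVariety k σ) : ∃ i : σ, (MvPolynomial.X i) ∉ X.ideal := by
  by_contra! h
  apply X.not_irrelevant_le
  intro F hF
  have hF0 : coeff 0 F = 0 := by
    have h1 : homogeneousComponent 0 F = 0 := by
      rw [← decomposition.decompose'_apply]
      exact hF
    rw [homogeneousComponent_zero] at h1
    exact C_injective _ _ (h1.trans C_0.symm)
  have hspan : Ideal.span (MvPolynomial.X '' Set.univ) ≤ X.ideal := by
    rw [Ideal.span_le]
    rintro _ ⟨i, -, rfl⟩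
    exact h i
  apply hspan
  rw [mem_ideal_span_X_image]
  intro m hm
  have hm0 : m ≠ 0 := by
    rintro rfl
    exact (mem_support_iff.1 hm) hF0
  obtain ⟨i, hi⟩ := Finsupp.ne_iff.1 hm0
  exact ⟨i, trivial, hi⟩

theorem homogeneousComponent_mem_ideal (X : ProjVariety k σ) {F : MvPolynomial σ k}
    (hF : F ∈ X.ideal) (d : ℕ) : homogeneousComponent d F ∈ X.ideal :=
  homogeneousComponent_mem_of_mem X.asHomogeneousIdeal.isHomogeneous hF d

/-- The vanishing of `X.ideal` at a vector depends on the line it spans only. -/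
theorem eval_mul_eq_zero (X : ProjVariety k σ) {z : σ → k} (hz : ∀ F ∈ X.ideal, eval z F = 0)
    (c : k) : ∀ F ∈ X.ideal, eval (fun i => c * z i) F = 0 := by
  intro F hF
  rw [← sum_homogeneousComponent F, map_sum]
  refine Finset.sum_eq_zero fun d _ => ?_
  rw [eval_mul_of_isHomogeneous (homogeneousComponent_isHomogeneous d F),
    hz _ (X.homogeneousComponent_mem_ideal hF d), mul_zero]

theorem exists_rep_mk {z : σ → k} (hz : z ≠ 0) :
    ∃ c : k, c ≠ 0 ∧ z = fun i => c * (Projectivization.mk k z hz).rep i := by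
  obtain ⟨c, hc⟩ := Projectivization.exists_smul_eq_mk_rep k z hz
  refine ⟨((c⁻¹ : kˣ) : k), Units.ne_zero _, ?_⟩
  rw [← hc]
  funext i
  simp [Units.smul_def]

theorem mk_mem_points (X : ProjVariety k σ) {z : σ → k} (hz0 : z ≠ 0)
    (hz : ∀ F ∈ X.ideal, eval z F = 0) : Projectivization.mk k z hz0 ∈ X.points := by
  obtain ⟨c, hc⟩ := Projectivization.exists_smul_eq_mk_rep k z hz0
  intro F hF
  have := X.eval_mul_eq_zero hz c F hF
  rw [← hc]
  exact this

/-- Hilbert's Nullstellensatz for the affine cone over `X`. -/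
theorem mem_ideal_of_forall_eval_eq_zero [IsAlgClosed k] [Finite σ] (X : ProjVariety k σ)
    {F : MvPolynomial σ k}
    (hF : ∀ z : σ → k, (∀ G ∈ X.ideal, eval z G = 0) → eval z F = 0) : F ∈ X.ideal := by
  rw [← IsPrime.vanishingIdeal_zeroLocus (K := k) X.ideal]
  intro z hz
  rw [aeval_eq_eval]
  exact hF z fun G hG => by simpa only [aeval_eq_eval] using hz G hG

/-- Hilbert's Nullstellensatz for the points of `X`. The polynomial is multiplied by a coordinate in
order to deal with the vertex of the cone. -/
theorem mem_ideal_of_forall_points [IsAlgClosed k] [Finite σ] (X : ProjVariety k σ) {d : ℕ}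
    {F : MvPolynomial σ k} (hFd : F.IsHomogeneous d)
    (hF : ∀ x ∈ X.points, eval x.rep F = 0) : F ∈ X.ideal := by
  obtain ⟨i, hi⟩ := X.exists_X_notMem
  refine (X.isPrime.mem_or_mem (x := MvPolynomial.X i) ?_).resolve_left hi
  refine X.mem_ideal_of_forall_eval_eq_zero fun z hz => ?_
  by_cases hz0 : z = 0
  · simp [hz0]
  · obtain ⟨c, -, hc⟩ := exists_rep_mk hz0
    rw [map_mul, hc, eval_mul_of_isHomogeneous hFd, hF _ (X.mk_mem_points hz0 hz), mul_zero, mul_zero]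

end Points

/-! ### Generic points -/

section Generic

variable {k : Type u} [Field k] {σ : Type}

/-- The vector `ξ` with entries in an extension `L` of `k` consists of homogeneous coordinates of a
generic point of `X`: the homogeneous polynomials vanishing at `ξ` are those of `I(X)`. -/
def IsGenericPoint {L : Type v} [Field L] [Algebra k L] (X : ProjVariety k σ) (ξ : σ → L) : Prop :=
  ∀ (d : ℕ) (F : MvPolynomial σ k), F.IsHomogeneous d → (F ∈ X.ideal ↔ aeval ξ F = 0)

/-- Every non-zero vector over an extension of `k` is a generic point of some variety. -/
theorem exists_isGenericPoint {L : Type v} [Field L] [Algebra k L] (ξ : σ → L) {i₀ : σ}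
    (h₀ : ξ i₀ = 1) : ∃ X : ProjVariety k σ, X.IsGenericPoint ξ := by
  classical
  let φ : MvPolynomial σ k →ₐ[k] Polynomial L := aeval fun i => Polynomial.X * Polynomial.C (ξ i)
  have hφ : ∀ F, F ∈ RingHom.ker φ ↔ ∀ d, aeval ξ (homogeneousComponent d F) = 0 := fun F => by
    rw [RingHom.mem_ker, Polynomial.ext_iff]
    exact forall_congr' fun d => by rw [coeff_aeval_C_mul_X, Polynomial.coeff_zero]
  have hcomp : ∀ {d : ℕ} {F : MvPolynomial σ k}, F.IsHomogeneous d →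
      (F ∈ RingHom.ker φ ↔ aeval ξ F = 0) := fun {d F} hF => by
    rw [hφ]
    constructor
    · intro h
      have := h d
      rwa [homogeneousComponent_of_mem hF, if_pos rfl] at this
    · intro h e
      rw [homogeneousComponent_of_mem hF]
      split_ifs
      · exact h
      · exact map_zero _
  refine ⟨⟨⟨RingHom.ker φ, fun d F hF => ?_⟩, RingHom.ker_isPrime φ, fun h => ?_⟩, fun d F hF => ?_⟩
  · have h1 : (DirectSum.decompose (homogeneousSubmodule σ k) F d : MvPolynomial σ k) =
        homogeneousComponent d F := decomposition.decompose'_apply F d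
    rw [h1]
    exact (hcomp (homogeneousComponent_isHomogeneous d F)).2 ((hφ F).1 hF d)
  · have h1 : (MvPolynomial.X i₀ : MvPolynomial σ k) ∈ RingHom.ker φ := by
      apply h
      have h2 : (DirectSum.decompose (homogeneousSubmodule σ k) (MvPolynomial.X i₀) 0 :
          MvPolynomial σ k) = homogeneousComponent 0 (MvPolynomial.X i₀) :=
        decomposition.decompose'_apply _ _
      have h3 : homogeneousComponent 0 (MvPolynomial.X i₀ : MvPolynomial σ k) = 0 := by
        rw [homogeneousComponent_zero]; simp
      exact h2.trans h3
    rw [hcomp (isHomogeneous_X k i₀), aeval_X, h₀] at h1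
    exact one_ne_zero h1
  · exact hcomp hF

end Generic

end ProjVariety

namespace ProjVariety

/-! ### The function field -/

section FunctionField

variable {k : Type u} [Field k] {σ : Type}

theorem exists_eq_fraction (X : ProjVariety k σ) (f : X.FunctionField) :
    ∃ (d : ℕ) (a b : homogeneousSubmodule σ k d) (hb : (b : MvPolynomial σ k) ∉ X.ideal),
      f = X.fraction d a b hb := by
  obtain ⟨f, rfl⟩ := Ideal.Quotient.mk_surjective f
  obtain ⟨⟨d, a, b, hb⟩, rfl⟩ := HomogeneousLocalization.mk_surjective f
  exact ⟨d, a, b, hb, rfl⟩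

/-- The rational functions `X_i / X_{i₀}`, the affine coordinates of the generic point of `X`. -/
noncomputable def genericCoord (X : ProjVariety k σ) {i₀ : σ}
    (h₀ : (MvPolynomial.X i₀) ∉ X.ideal) (i : σ) : X.FunctionField :=
  X.fraction 1 ⟨MvPolynomial.X i, isHomogeneous_X k i⟩ ⟨MvPolynomial.X i₀, isHomogeneous_X k i₀⟩ h₀

theorem X_pow_notMem (X : ProjVariety k σ) {i₀ : σ}
    (h₀ : (MvPolynomial.X i₀) ∉ X.ideal) (d : ℕ) : (MvPolynomial.X i₀ ^ d) ∉ X.ideal :=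
  fun h => h₀ (X.isPrime.mem_of_pow_mem d h)

theorem X_pow_mem (i₀ : σ) (d : ℕ) :
    (MvPolynomial.X i₀ ^ d : MvPolynomial σ k) ∈ homogeneousSubmodule σ k d := by
  have := isHomogeneous_X_pow (R := k) i₀ d
  exact this

theorem aeval_genericCoord (X : ProjVariety k σ) {i₀ : σ} (h₀ : (MvPolynomial.X i₀) ∉ X.ideal)
    {d : ℕ} (a : homogeneousSubmodule σ k d) :
    aeval (X.genericCoord h₀) (a : MvPolynomial σ k) =
      X.fraction d a ⟨MvPolynomial.X i₀ ^ d, X_pow_mem i₀ d⟩ (X.X_pow_notMem h₀ d) := by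
  let c : k →+* X.GenericLocalRing :=
    (HomogeneousLocalization.fromZeroRingHom (homogeneousSubmodule σ k)
        X.asHomogeneousIdeal.toIdeal.primeCompl).comp
      (algebraMap k (homogeneousSubmodule σ k 0))
  let η : σ → X.GenericLocalRing := fun i => HomogeneousLocalization.mk
    ⟨1, ⟨MvPolynomial.X i, isHomogeneous_X k i⟩, ⟨MvPolynomial.X i₀, isHomogeneous_X k i₀⟩,
      Ideal.mem_primeCompl_iff.2 h₀⟩
  have h1 : aeval (X.genericCoord h₀) (a : MvPolynomial σ k) =
      IsLocalRing.residue X.GenericLocalRing (eval₂Hom c η (a : MvPolynomial σ k)) := by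
    rw [map_eval₂Hom]
    rfl
  rw [h1]
  apply congrArg (IsLocalRing.residue X.GenericLocalRing)
  apply HomogeneousLocalization.val_injective
  have h2 : HomogeneousLocalization.val (eval₂Hom c η (a : MvPolynomial σ k)) =
      aeval (fun i => Localization.mk 1 ⟨MvPolynomial.X i₀, Ideal.mem_primeCompl_iff.2 h₀⟩ *
        algebraMap (MvPolynomial σ k)
          (Localization X.asHomogeneousIdeal.toIdeal.primeCompl) (MvPolynomial.X i))
        (a : MvPolynomial σ k) := by
    have h3 : HomogeneousLocalization.val (eval₂Hom c η (a : MvPolynomial σ k)) =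
      algebraMap X.GenericLocalRing (Localization X.asHomogeneousIdeal.toIdeal.primeCompl)
        (eval₂Hom c η (a : MvPolynomial σ k)) := rfl
    rw [h3, map_eval₂Hom, aeval_eq_eval₂Hom]
    congr 2
    · funext i
      change HomogeneousLocalization.val (η i) = _
      rw [HomogeneousLocalization.val_mk, ← Localization.mk_one_eq_algebraMap, Localization.mk_mul]
      simp
  rw [h2, aeval_mul_of_isHomogeneous a.2, HomogeneousLocalization.val_mk]
  have h4 : aeval (fun i => algebraMap (MvPolynomial σ k)
          (Localization X.asHomogeneousIdeal.toIdeal.primeCompl) (MvPolynomial.X i))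
        (a : MvPolynomial σ k) = algebraMap (MvPolynomial σ k)
          (Localization X.asHomogeneousIdeal.toIdeal.primeCompl) (a : MvPolynomial σ k) := by
    have := aeval_algebraMap_apply (R := k)
      (Localization X.asHomogeneousIdeal.toIdeal.primeCompl)
      (MvPolynomial.X : σ → MvPolynomial σ k) (a : MvPolynomial σ k)
    rw [aeval_X_left_apply] at this
    exact this
  rw [h4, Localization.mk_pow, ← Localization.mk_one_eq_algebraMap, Localization.mk_mul]
  simp

theorem fraction_mul_fraction (X : ProjVariety k σ) {d : ℕ}
    {a b c : homogeneousSubmodule σ k d} (hb : (b : MvPolynomial σ k) ∉ X.ideal)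
    (hc : (c : MvPolynomial σ k) ∉ X.ideal) :
    X.fraction d a b hb * X.fraction d b c hc = X.fraction d a c hc := by
  refine (map_mul (IsLocalRing.residue X.GenericLocalRing) _ _).symm.trans
    (congrArg (IsLocalRing.residue X.GenericLocalRing) ?_)
  apply HomogeneousLocalization.val_injective
  rw [HomogeneousLocalization.val_mul, HomogeneousLocalization.val_mk,
    HomogeneousLocalization.val_mk, HomogeneousLocalization.val_mk, Localization.mk_mul,
    Localization.mk_eq_mk_iff, Localization.r_iff_exists]
  exact ⟨1, by simp; ring⟩

theorem fraction_eq_zero_iff (X : ProjVariety k σ) {d : ℕ}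
    {a b : homogeneousSubmodule σ k d} (hb : (b : MvPolynomial σ k) ∉ X.ideal) :
    X.fraction d a b hb = 0 ↔ (a : MvPolynomial σ k) ∈ X.ideal := by
  refine (IsLocalRing.residue_eq_zero_iff (R := X.GenericLocalRing) _).trans ?_
  rw [IsLocalRing.mem_maximalIdeal, mem_nonunits_iff,
    ← HomogeneousLocalization.isUnit_iff_isUnit_val, HomogeneousLocalization.val_mk,
    Localization.mk_eq_mk', IsLocalization.AtPrime.isUnit_mk'_iff _ X.ideal,
    Ideal.mem_primeCompl_iff, not_not]

theorem isGenericPoint_genericCoord (X : ProjVariety k σ) {i₀ : σ}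
    (h₀ : (MvPolynomial.X i₀) ∉ X.ideal) : X.IsGenericPoint (X.genericCoord h₀) := by
  intro d F hF
  have := X.aeval_genericCoord h₀ ⟨F, hF⟩
  simp only at this
  rw [this, fraction_eq_zero_iff]

theorem fraction_eq_div (X : ProjVariety k σ) {i₀ : σ} (h₀ : (MvPolynomial.X i₀) ∉ X.ideal)
    {d : ℕ} (a b : homogeneousSubmodule σ k d) (hb : (b : MvPolynomial σ k) ∉ X.ideal) :
    X.fraction d a b hb = aeval (X.genericCoord h₀) (a : MvPolynomial σ k) /
      aeval (X.genericCoord h₀) (b : MvPolynomial σ k) := by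
  rw [eq_div_iff, aeval_genericCoord, aeval_genericCoord, fraction_mul_fraction]
  rw [Ne, ← X.isGenericPoint_genericCoord h₀ d _ b.2]
  exact hb

theorem genericCoord_self (X : ProjVariety k σ) {i₀ : σ} (h₀ : (MvPolynomial.X i₀) ∉ X.ideal) :
    X.genericCoord h₀ i₀ = 1 := by
  rw [genericCoord, fraction_eq_div X h₀, div_self]
  rw [Ne, ← X.isGenericPoint_genericCoord h₀ 1 _ (isHomogeneous_X k i₀)]
  exact h₀

theorem adjoin_genericCoord (X : ProjVariety k σ) {i₀ : σ} (h₀ : (MvPolynomial.X i₀) ∉ X.ideal) :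
    IntermediateField.adjoin k (Set.range (X.genericCoord h₀)) = ⊤ := by
  rw [eq_top_iff]
  intro f _
  obtain ⟨d, a, b, hb, rfl⟩ := X.exists_eq_fraction f
  rw [fraction_eq_div X h₀, IntermediateField.mem_adjoin_range_iff]
  exact ⟨a, b, rfl⟩

theorem essFiniteType_functionField [Finite σ] (X : ProjVariety k σ) :
    Algebra.EssFiniteType k X.FunctionField := by
  obtain ⟨i₀, h₀⟩ := X.exists_X_notMem
  rw [← IntermediateField.fg_top_iff, ← X.adjoin_genericCoord h₀]
  exact IntermediateField.fg_adjoin_of_finite (Set.finite_range _)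

end FunctionField

end ProjVariety

/-- A field generated by the values `ζ i` is the fraction field of the ring they generate. -/
theorem isFractionRing_range_aeval {k K σ : Type*} [Field k] [Field K] [Algebra k K] {ζ : σ → K}
    (hζ : IntermediateField.adjoin k (Set.range ζ) = ⊤) :
    IsFractionRing (aeval (R := k) ζ).range K := by
  refine IsFractionRing.of_field _ _ fun z => ?_
  have hz : z ∈ IntermediateField.adjoin k (Set.range ζ) := hζ ▸ IntermediateField.mem_top
  obtain ⟨r, s, rfl⟩ := (IntermediateField.mem_adjoin_range_iff k ζ z).1 hz
  exact ⟨⟨_, r, rfl⟩, ⟨_, s, rfl⟩, rfl⟩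

/-- Two families of generators of field extensions that satisfy the same algebraic relations are
conjugate. -/
theorem exists_algEquiv_of_aeval_eq_zero_iff {k K L σ : Type*} [Field k] [Field K] [Field L]
    [Algebra k K] [Algebra k L] {η : σ → K} {ξ : σ → L}
    (hη : IntermediateField.adjoin k (Set.range η) = ⊤)
    (hξ : IntermediateField.adjoin k (Set.range ξ) = ⊤)
    (h : ∀ F : MvPolynomial σ k, aeval η F = 0 ↔ aeval ξ F = 0) :
    ∃ e : K ≃ₐ[k] L, ∀ i, e (η i) = ξ i := by
  have := isFractionRing_range_aeval hη
  have := isFractionRing_range_aeval hξ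
  have hker : RingHom.ker (aeval (R := k) η) = RingHom.ker (aeval (R := k) ξ) :=
    Ideal.ext fun F => h F
  let g : (aeval (R := k) η).range ≃ₐ[k] (aeval (R := k) ξ).range :=
    ((Ideal.quotientKerEquivRange (aeval (R := k) η)).symm.trans
      (Ideal.quotientEquivAlgOfEq k hker)).trans (Ideal.quotientKerEquivRange (aeval (R := k) ξ))
  have hg : ∀ F : MvPolynomial σ k, g ⟨aeval η F, F, rfl⟩ = ⟨aeval ξ F, F, rfl⟩ := by
    intro F
    have : (Ideal.quotientKerEquivRange (aeval (R := k) η)).symm ⟨aeval η F, F, rfl⟩ =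
        Ideal.Quotient.mk _ F := by
      rw [AlgEquiv.symm_apply_eq]; rfl
    simp only [g, AlgEquiv.trans_apply, this]
    rfl
  refine ⟨IsFractionRing.algEquivOfAlgEquiv g, fun i => ?_⟩
  have h1 := IsFractionRing.algEquivOfAlgEquiv_algebraMap (K := K) (L := L) g
    ⟨aeval η (X i), X i, rfl⟩
  rw [hg] at h1
  have h2 : algebraMap (aeval (R := k) η).range K ⟨aeval η (X i), X i, rfl⟩ = η i := aeval_X η i
  have h3 : algebraMap (aeval (R := k) ξ).range L ⟨aeval ξ (X i), X i, rfl⟩ = ξ i := aeval_X ξ i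
  rwa [h2, h3] at h1

namespace ProjVariety

variable {k : Type u} [Field k] {σ : Type}

/-- If the coordinates of the generic point `ξ` generate `L`, then `L` is the function field, and
the rational functions are the values of fractions at `ξ`. -/
theorem IsGenericPoint.exists_algEquiv {L : Type v} [Field L] [Algebra k L] {X : ProjVariety k σ}
    {ξ : σ → L} (hX : X.IsGenericPoint ξ) {i₀ : σ} (h₀ : ξ i₀ = 1)
    (hξ : IntermediateField.adjoin k (Set.range ξ) = ⊤) :
    ∃ e : X.FunctionField ≃ₐ[k] L, ∀ (d : ℕ) (a b : homogeneousSubmodule σ k d)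
      (hb : (b : MvPolynomial σ k) ∉ X.ideal),
        e (X.fraction d a b hb) =
          aeval ξ (a : MvPolynomial σ k) / aeval ξ (b : MvPolynomial σ k) := by
  have hi₀ : (MvPolynomial.X i₀) ∉ X.ideal := by
    rw [hX 1 _ (isHomogeneous_X k i₀), aeval_X, h₀]
    exact one_ne_zero
  have hη := X.isGenericPoint_genericCoord hi₀
  obtain ⟨e, he⟩ := exists_algEquiv_of_aeval_eq_zero_iff (X.adjoin_genericCoord hi₀) hξ
    fun G => by
      -- homogenizing `G` does not change its values at the two generic points
      rw [← aeval_homogenization h₀ G, ← aeval_homogenization (X.genericCoord_self hi₀) G,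
        ← hX _ _ (isHomogeneous_homogenization i₀ G), ← hη _ _ (isHomogeneous_homogenization i₀ G)]
  refine ⟨e, fun d a b hb => ?_⟩
  have he' : ∀ F : MvPolynomial σ k, e (aeval (X.genericCoord hi₀) F) = aeval ξ F := fun F => by
    have := comp_aeval_apply (f := X.genericCoord hi₀) (e : X.FunctionField →ₐ[k] L) F
    simpa [he] using this
  rw [fraction_eq_div X hi₀, map_div₀, he', he']

end ProjVariety

/-! ### Minors and Plücker points -/

/-- The maximal minor, with columns `J`, of a matrix with rows `b i` over a commutative ring. -/
def minor {R : Type*} [CommRing R] {n N : ℕ} (b : Fin (n + 1) → Fin (N + 1) → R)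
    (J : PluckerIndex n N) : R :=
  Matrix.det (Matrix.of fun i j => b i (J j))

theorem map_minor {R S : Type*} [CommRing R] [CommRing S] {n N : ℕ} (f : R →+* S)
    (b : Fin (n + 1) → Fin (N + 1) → R) (J : PluckerIndex n N) :
    f (minor b J) = minor (fun i j => f (b i j)) J := by
  rw [minor, RingHom.map_det]
  rfl

/-- A change of basis multiplies all minors by its determinant. -/
theorem minor_mul {R : Type*} [CommRing R] {n N : ℕ} (P : Matrix (Fin (n + 1)) (Fin (n + 1)) R)
    (b : Fin (n + 1) → Fin (N + 1) → R) (J : PluckerIndex n N) :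
    minor (fun i j => ∑ m, P i m * b m j) J = P.det * minor b J := by
  rw [minor, minor, ← Matrix.det_mul]
  rfl

theorem minor_smul {R : Type*} [CommRing R] {n N : ℕ} (c : R)
    (b : Fin (n + 1) → Fin (N + 1) → R) (J : PluckerIndex n N) :
    minor (fun i j => c * b i j) J = c ^ (n + 1) * minor b J := by
  rw [minor, minor]
  have := Matrix.det_smul (Matrix.of fun i j => b i (J j)) c
  rw [Fintype.card_fin] at this
  rw [← this]
  rfl

theorem minor_isHomogeneous {R σ : Type*} [CommRing R] {n N D : ℕ}
    {b : Fin (n + 1) → Fin (N + 1) → MvPolynomial σ R} (hb : ∀ i j, (b i j).IsHomogeneous D)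
    (J : PluckerIndex n N) : (minor b J).IsHomogeneous (D * (n + 1)) := by
  rw [minor, Matrix.det_apply]
  refine IsHomogeneous.sum _ _ _ fun s _ => ?_
  have h1 : (∏ i, Matrix.of (fun i j => b i (J j)) (s i) i).IsHomogeneous (D * (n + 1)) := by
    have := IsHomogeneous.prod Finset.univ (fun i => Matrix.of (fun i j => b i (J j)) (s i) i)
      (fun _ => D) fun i _ => hb _ _
    simpa [mul_comm] using this
  rw [Units.smul_def, zsmul_eq_mul, ← map_intCast (C : R →+* MvPolynomial σ R)]
  exact h1.C_mul _

/-- The Plücker point of a subspace does not depend on the basis. -/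
theorem IsPluckerPoint.unique {k : Type u} [Field k] {n N : ℕ}
    {W : Submodule k (Fin (N + 1) → k)} {y y' : ℙ k (PluckerIndex n N → k)}
    (hy : IsPluckerPoint W y) (hy' : IsPluckerPoint W y') : y = y' := by
  obtain ⟨b, hb, rfl⟩ := hy
  obtain ⟨b', hb', rfl⟩ := hy'
  have h : ∀ J, pluckerVector (fun i => (b i : Fin (N + 1) → k)) J =
      (Matrix.of fun i m => b'.repr (b i) m).det *
        pluckerVector (fun i => (b' i : Fin (N + 1) → k)) J := by
    intro J
    have := minor_mul (Matrix.of fun i m => b'.repr (b i) m)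
      (fun i => (b' i : Fin (N + 1) → k)) J
    have h2 : (fun i j => ∑ m, (Matrix.of fun i m => b'.repr (b i) m) i m *
        (b' m : Fin (N + 1) → k) j) = fun i => (b i : Fin (N + 1) → k) := by
      funext i j
      have h3 := congrArg (fun w : W => (w : Fin (N + 1) → k) j) (b'.sum_repr (b i))
      simpa only [Submodule.coe_sum, Finset.sum_apply, Submodule.coe_smul, Pi.smul_apply,
        smul_eq_mul, Matrix.of_apply] using h3
    rw [h2] at this
    exact this
  rw [Projectivization.mk_eq_mk_iff']
  exact ⟨_, (funext h).symm⟩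

namespace ProjVariety

/-- It suffices to test the homogeneous elements of `I(X)`. -/
theorem eval_eq_zero_of_isHomogeneous {k : Type u} [Field k] {σ : Type} (X : ProjVariety k σ)
    {z : σ → k}
    (hz : ∀ (d : ℕ) (F : MvPolynomial σ k), F.IsHomogeneous d → F ∈ X.ideal → eval z F = 0) :
    ∀ F ∈ X.ideal, eval z F = 0 := by
  intro F hF
  rw [← sum_homogeneousComponent F, map_sum]
  exact Finset.sum_eq_zero fun d _ => hz d _ (homogeneousComponent_isHomogeneous d F)
    (X.homogeneousComponent_mem_ideal hF d)

/-! ### The Gauss map on an open set -/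

section Chart

variable {k : Type u} [Field k] {n N : ℕ}

/-- The vector `v` is tangent at the vector `z` to the affine cone over `X`. -/
def IsTangent {σ : Type} [Fintype σ] (X : ProjVariety k σ) (z v : σ → k) : Prop :=
  ∀ F ∈ X.ideal, ∑ j, eval z (pderiv j F) * v j = 0

theorem mem_tangentSpace_iff {σ : Type} [Fintype σ] (X : ProjVariety k σ) (x : ℙ k (σ → k))
    (v : σ → k) : v ∈ X.tangentSpace x ↔ X.IsTangent x.rep v := Iff.rfl

/-- A description of the Gauss map of an `n`-dimensional variety `X` on the open set `h ≠ 0`: the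
rows of the matrix `α` of forms of degree `D` span the tangent space, and the columns `J₀` of `α`
form `β` times the unit matrix. The minors of `α`, which are the Plücker coordinates of the tangent
space, satisfy exactly the homogeneous equations of `Y`. -/
structure GaussChart (X : ProjVariety k (Fin (N + 1))) (Y : ProjVariety k (PluckerIndex n N)) where
  /-- the columns in which `α` is a multiple of the unit matrix -/
  J₀ : PluckerIndex n N
  /-- the degree of the entries of `α` -/
  D : ℕ
  /-- the matrix whose rows span the tangent space -/
  α : Fin (n + 1) → Fin (N + 1) → MvPolynomial (Fin (N + 1)) k
  /-- the common denominator -/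
  β : MvPolynomial (Fin (N + 1)) k
  /-- the degree of `h` -/
  e : ℕ
  /-- the equation of the complement of the open set -/
  h : MvPolynomial (Fin (N + 1)) k
  dim_eq : X.dim = n
  α_hom : ∀ i j, (α i j).IsHomogeneous D
  h_hom : h.IsHomogeneous e
  h_notMem : h ∉ X.ideal
  β_ne_zero : ∀ z : Fin (N + 1) → k, eval z h ≠ 0 → eval z β ≠ 0
  α_J₀ : ∀ z : Fin (N + 1) → k, (∀ F ∈ X.ideal, eval z F = 0) → ∀ i i',
    eval z (α i (J₀ i')) = if i = i' then eval z β else 0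
  isTangent_iff : ∀ z : Fin (N + 1) → k, (∀ F ∈ X.ideal, eval z F = 0) → eval z h ≠ 0 → ∀ v,
    X.IsTangent z v ↔ ∃ c : Fin (n + 1) → k, ∀ j, v j = ∑ i, c i * eval z (α i j)
  mem_ideal_iff : ∀ (d : ℕ) (G : MvPolynomial (PluckerIndex n N) k), G.IsHomogeneous d →
    (G ∈ Y.ideal ↔ aeval (minor α) G ∈ X.ideal)

namespace GaussChart

variable {X : ProjVariety k (Fin (N + 1))} {Y : ProjVariety k (PluckerIndex n N)}
  (T : GaussChart X Y)

theorem eval_aeval_minor (α : Fin (n + 1) → Fin (N + 1) → MvPolynomial (Fin (N + 1)) k)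
    (z : Fin (N + 1) → k) (G : MvPolynomial (PluckerIndex n N) k) :
    eval z (aeval (minor α) G) = eval (minor fun i j => eval z (α i j)) G := by
  have h := comp_aeval_apply (f := minor α) (aeval z : MvPolynomial (Fin (N + 1)) k →ₐ[k] k) G
  rw [aeval_eq_eval] at h
  rw [h, aeval_eq_eval]
  congr 2
  funext J
  exact map_minor (eval z) α J

theorem minor_J₀ {z : Fin (N + 1) → k} (hz : ∀ F ∈ X.ideal, eval z F = 0) :
    minor (fun i j => eval z (T.α i j)) T.J₀ = eval z T.β ^ (n + 1) := by
  have : (Matrix.of fun i j => eval z (T.α i (T.J₀ j))) =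
      Matrix.diagonal fun _ => eval z T.β := by
    ext i j
    rw [Matrix.of_apply, T.α_J₀ z hz, Matrix.diagonal_apply]
  rw [minor, this, Matrix.det_diagonal]
  simp

theorem minor_ne_zero {z : Fin (N + 1) → k} (hz : ∀ F ∈ X.ideal, eval z F = 0)
    (hh : eval z T.h ≠ 0) : (minor fun i j => eval z (T.α i j)) ≠ 0 := fun h => by
  have := congrFun h T.J₀
  rw [T.minor_J₀ hz] at this
  exact pow_ne_zero _ (T.β_ne_zero z hh) this

theorem aeval_minor_isHomogeneous {d : ℕ} {G : MvPolynomial (PluckerIndex n N) k}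
    (hG : G.IsHomogeneous d) : (aeval (minor T.α) G).IsHomogeneous (T.D * (n + 1) * d) :=
  hG.aeval _ fun J => minor_isHomogeneous T.α_hom J

/-- On the open set `h ≠ 0` the Gauss map is given by the minors of `α`. -/
theorem gaussMap {x : ℙ k (Fin (N + 1) → k)} (hx : x ∈ X.points) (hh : eval x.rep T.h ≠ 0) :
    X.GaussMap x (Projectivization.mk k _ (T.minor_ne_zero hx hh)) := by
  let r : Fin (n + 1) → X.tangentSpace x := fun i => ⟨fun j => eval x.rep (T.α i j), by
    rw [mem_tangentSpace_iff, T.isTangent_iff _ hx hh]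
    exact ⟨Pi.single i 1, fun j => by simp [Pi.single_apply]⟩⟩
  have hβ := T.β_ne_zero _ hh
  have hli : LinearIndependent k r := by
    rw [Fintype.linearIndependent_iff]
    intro c hc i
    have h1 := congrArg (fun w : X.tangentSpace x => (w : Fin (N + 1) → k) (T.J₀ i)) hc
    simp only [Submodule.coe_sum, Submodule.coe_smul, Finset.sum_apply, Pi.smul_apply, smul_eq_mul,
      r, T.α_J₀ _ hx, Submodule.coe_zero, Pi.zero_apply] at h1
    simpa [hβ] using h1
  have hsp : ⊤ ≤ Submodule.span k (Set.range r) := by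
    intro w _
    obtain ⟨c, hc⟩ := (T.isTangent_iff _ hx hh w).1 w.2
    have : w = ∑ i, c i • r i := by
      ext j
      simp [r, hc j]
    rw [this]
    exact Submodule.sum_mem _ fun i _ => Submodule.smul_mem _ _ (Submodule.subset_span ⟨i, rfl⟩)
  let B := Module.Basis.mk hli hsp
  have hB : (fun i => (B i : Fin (N + 1) → k)) = fun i j => eval x.rep (T.α i j) := by
    funext i
    rw [Module.Basis.mk_apply]
  refine ⟨⟨hx, ?_⟩, B, ?_, ?_⟩
  · rw [T.dim_eq, rank_eq_card_basis B, Fintype.card_fin]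
    simp
  · rw [hB]; exact T.minor_ne_zero hx hh
  · congr 1
    rw [hB]
    rfl

theorem mk_minor_mem_points {x : ℙ k (Fin (N + 1) → k)} (hx : x ∈ X.points)
    (hh : eval x.rep T.h ≠ 0) :
    Projectivization.mk k _ (T.minor_ne_zero hx hh) ∈ Y.points := by
  apply Y.mk_mem_points
  apply Y.eval_eq_zero_of_isHomogeneous
  intro d G hG hGY
  have := hx _ ((T.mem_ideal_iff d G hG).1 hGY)
  rwa [eval_aeval_minor] at this

end GaussChart

end Chart

end ProjVariety

namespace ProjVariety

/-! ### The closure of the Gauss image and the pull-back -/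

section Chart

variable {k : Type u} [Field k] {n N : ℕ}

/-- At a smooth point there are equations of `X` whose gradients, outside of the columns `J₁` of a
non-zero Plücker coordinate of the tangent space, are the standard basis vectors. -/
theorem exists_gradient_eq_single (X : ProjVariety k (Fin (N + 1))) {z : Fin (N + 1) → k}
    {b : Fin (n + 1) → Fin (N + 1) → k}
    (hb : ∀ v, X.IsTangent z v → ∃ c : Fin (n + 1) → k, ∀ j, v j = ∑ i, c i * b i j)
    {J₁ : PluckerIndex n N} (hJ₁ : minor b J₁ ≠ 0) (j : {m // m ∉ Set.range J₁}) :
    ∃ F ∈ X.ideal, ∀ m : {m // m ∉ Set.range J₁},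
      eval z (pderiv (m : Fin (N + 1)) F) = if j = m then 1 else 0 := by
  classical
  let Γ : X.ideal →ₗ[k] ({m // m ∉ Set.range J₁} → k) :=
    { toFun := fun F m => eval z (pderiv (m : Fin (N + 1)) (F : MvPolynomial (Fin (N + 1)) k))
      map_add' := fun F G => by funext m; simp
      map_smul' := fun c F => by funext m; simp }
  have hΓ : LinearMap.range Γ = ⊤ := by
    by_contra hne
    obtain ⟨f, hf0, hf⟩ := Submodule.exists_le_ker_of_lt_top _ (lt_top_iff_ne_top.2 hne)
    apply hf0
    have hfw : ∀ w, f w = ∑ m, w m * f (Pi.single m 1) := fun w => by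
      conv_lhs => rw [pi_eq_sum_univ' w]
      simp [map_sum]
    -- the functional `f` extended by zero is a tangent vector without entries in `J₁`
    let v : Fin (N + 1) → k := fun m =>
      if hm : m ∉ Set.range J₁ then f (Pi.single ⟨m, hm⟩ 1) else 0
    have hv : X.IsTangent z v := by
      intro F hF
      have h1 : f (Γ ⟨F, hF⟩) = 0 := hf ⟨_, rfl⟩
      rw [hfw] at h1
      rw [← h1, ← Fintype.sum_subtype_add_sum_subtype (fun m => m ∉ Set.range J₁)]
      have h2 : ∑ m : {m // ¬ m ∉ Set.range J₁}, eval z (pderiv (m : Fin (N + 1)) F) * v m = 0 :=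
        Finset.sum_eq_zero fun m _ => by simp only [v, dif_neg m.2, mul_zero]
      rw [h2, add_zero]
      refine Finset.sum_congr rfl fun m _ => ?_
      simp only [v, dif_pos m.2]
      rfl
    obtain ⟨c, hc⟩ := hb v hv
    have hc0 : c = 0 := by
      by_contra hc0
      apply hJ₁
      rw [minor, ← Matrix.exists_vecMul_eq_zero_iff]
      refine ⟨c, hc0, ?_⟩
      funext i
      have h1 := hc (J₁ i)
      have h2 : v (J₁ i) = 0 := dif_neg (not_not.2 ⟨i, rfl⟩)
      rw [h2] at h1
      exact h1.symm
    ext m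
    have h1 := hc m
    have h2 : v m = f (Pi.single m 1) := dif_pos m.2
    rw [h2, hc0] at h1
    simpa using h1
  have hj : Pi.single j 1 ∈ LinearMap.range Γ := hΓ ▸ Submodule.mem_top
  obtain ⟨F, hF⟩ := hj
  refine ⟨F, F.2, fun m => ?_⟩
  have := congrFun hF m
  rw [Pi.single_apply] at this
  simp only [eq_comm (a := j)]
  exact this

/-- Cramer's rule for tangent vectors: if the minor `C` of the Jacobian matrix of the equations `F`
with the columns outside of `J₁` does not vanish, the tangent vectors are determined by their
entries in `J₁`. The matrix `K` expresses them without denominators. -/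
theorem exists_solution_matrix (X : ProjVariety k (Fin (N + 1))) (J₁ : PluckerIndex n N)
    (F : {m // m ∉ Set.range J₁} → MvPolynomial (Fin (N + 1)) k) (hF : ∀ j, F j ∈ X.ideal) :
    ∃ K : Fin (n + 1) → Fin (N + 1) → MvPolynomial (Fin (N + 1)) k, ∀ z v, X.IsTangent z v →
      ∀ m, eval z (Matrix.of fun j (m : {m // m ∉ Set.range J₁}) =>
          pderiv (m : Fin (N + 1)) (F j)).det * v m =
        ∑ i, v (J₁ i) * eval z (K i m) := by
  classical
  set C := Matrix.of fun j (m : {m // m ∉ Set.range J₁}) => pderiv (m : Fin (N + 1)) (F j) with hC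
  let B := Matrix.of fun j (i : Fin (n + 1)) => pderiv (J₁ i) (F j)
  refine ⟨fun i m => if hm : m ∉ Set.range J₁ then - (C.adjugate * B) ⟨m, hm⟩ i
    else if J₁ i = m then C.det else 0, fun z v hv m => ?_⟩
  by_cases hm : m ∉ Set.range J₁
  · simp only [dif_pos hm]
    let Cz := (eval z).mapMatrix C
    let Bz := B.map (eval z)
    let vS : {m // m ∉ Set.range J₁} → k := fun m => v m
    let vJ : Fin (n + 1) → k := fun i => v (J₁ i)
    have h1 : Cz.mulVec vS = - Bz.mulVec vJ := by
      funext j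
      have h2 := hv _ (hF j)
      rw [← Fintype.sum_subtype_add_sum_subtype (fun m => m ∉ Set.range J₁)] at h2
      have h3 : ∑ m : {m // ¬ m ∉ Set.range J₁}, eval z (pderiv (m : Fin (N + 1)) (F j)) * v m =
          ∑ i, eval z (pderiv (J₁ i) (F j)) * v (J₁ i) := by
        let e : Fin (n + 1) ≃ {m // ¬ m ∉ Set.range J₁} :=
          (Equiv.ofInjective J₁ J₁.injective).trans (Equiv.subtypeEquivRight fun m => by simp)
        rw [← e.sum_comp]
        rfl
      rw [h3] at h2
      exact eq_neg_of_add_eq_zero_left h2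
    have h4 : Cz.det • vS = - (Cz.adjugate * Bz).mulVec vJ := by
      have h5 := congrArg (Cz.adjugate.mulVec) h1
      rw [Matrix.mulVec_mulVec, Matrix.adjugate_mul, Matrix.smul_mulVec, Matrix.one_mulVec,
        Matrix.mulVec_neg, Matrix.mulVec_mulVec] at h5
      exact h5
    have h6 := congrFun h4 ⟨m, hm⟩
    have h7 : Cz.det = eval z C.det := (RingHom.map_det _ _).symm
    have h8 : Cz.adjugate * Bz = (C.adjugate * B).map (eval z) := by
      rw [Matrix.map_mul]
      congr 1
      exact (RingHom.map_adjugate (eval z) C).symm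
    rw [h7, h8] at h6
    refine h6.trans ?_
    simp only [Pi.neg_apply, Matrix.mulVec, dotProduct, Matrix.map_apply, map_neg]
    rw [← Finset.sum_neg_distrib]
    exact Finset.sum_congr rfl fun i _ => by simp only [vJ]; ring
  · simp only [dif_neg hm]
    rw [not_not] at hm
    obtain ⟨i, rfl⟩ := hm
    rw [Finset.sum_eq_single i]
    · rw [if_pos rfl, mul_comm]
    · intro i' _ hi'
      rw [if_neg (fun h => hi' (J₁.injective h)), map_zero, mul_zero]
    · exact fun h => absurd (Finset.mem_univ i) h

namespace GaussChart

variable {X : ProjVariety k (Fin (N + 1))} {Y : ProjVariety k (PluckerIndex n N)}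

/-- The Gauss map sends all smooth points of `X` to `Y`, not only those in the open set `h ≠ 0`:
around a smooth point, the Plücker coordinates of the tangent space can be written as polynomials by
Cramer's rule, and the equations of `Y` hold for them as they hold on a dense open set. -/
theorem gaussImage_subset [IsAlgClosed k] (T : GaussChart X Y) : X.gaussImage n ⊆ Y.points := by
  rintro _ ⟨x, ⟨⟨hx, -⟩, B, hB0, rfl⟩⟩
  set b : Fin (n + 1) → Fin (N + 1) → k := fun i => (B i : Fin (N + 1) → k) with hb
  have hbt : ∀ i, X.IsTangent x.rep (b i) := fun i => (B i).2
  have hbspan : ∀ v, X.IsTangent x.rep v → ∃ c : Fin (n + 1) → k, ∀ j, v j = ∑ i, c i * b i j := by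
    intro v hv
    refine ⟨B.repr ⟨v, hv⟩, fun j => ?_⟩
    have := congrArg (fun w : X.tangentSpace x => (w : Fin (N + 1) → k) j) (B.sum_repr ⟨v, hv⟩)
    simpa only [Submodule.coe_sum, Finset.sum_apply, Submodule.coe_smul, Pi.smul_apply,
        smul_eq_mul] using this.symm
  obtain ⟨J₁, hJ₁⟩ := Function.ne_iff.1 hB0
  have hJ₁' : minor b J₁ ≠ 0 := hJ₁
  choose F hF hFg using X.exists_gradient_eq_single hbspan hJ₁'
  obtain ⟨K, hK⟩ := X.exists_solution_matrix J₁ F hF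
  set C := Matrix.of fun j (m : {m // m ∉ Set.range J₁}) => pderiv (m : Fin (N + 1)) (F j) with hC
  have hCx : eval x.rep C.det = 1 := by
    have : (eval x.rep).mapMatrix C = 1 := by
      ext j m
      rw [RingHom.mapMatrix_apply, Matrix.map_apply, hC, Matrix.of_apply, hFg, Matrix.one_apply]
    rw [RingHom.map_det, this, Matrix.det_one]
  have hKminor : ∀ (z : Fin (N + 1) → k) (r : Fin (n + 1) → Fin (N + 1) → k),
      (∀ i, X.IsTangent z (r i)) → ∀ J, eval z C.det ^ (n + 1) * minor r J =
        minor r J₁ * minor (fun i j => eval z (K i j)) J := by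
    intro z r hr J
    rw [← minor_smul]
    have h1 : (fun i j => eval z C.det * r i j) = fun i j =>
        ∑ m, (Matrix.of fun i m => r i (J₁ m)) i m * eval z (K m j) := by
      funext i j
      exact hK z (r i) (hr i) j
    rw [h1, minor_mul]
    rfl
  apply Y.mk_mem_points
  apply Y.eval_eq_zero_of_isHomogeneous
  intro d G hG hGY
  -- the equation `G` of `Y` holds for the minors of `K` on the open set `h * C.det ≠ 0`
  have hmem : T.h * C.det * aeval (minor K) G ∈ X.ideal := by
    refine X.mem_ideal_of_forall_eval_eq_zero fun z hz => ?_
    rw [map_mul, map_mul]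
    by_cases hh : eval z T.h = 0
    · rw [hh, zero_mul, zero_mul]
    by_cases hCz : eval z C.det = 0
    · rw [hCz, mul_zero, zero_mul]
    set r : Fin (n + 1) → Fin (N + 1) → k := fun i j => eval z (T.α i j) with hr
    have hrt : ∀ i, X.IsTangent z (r i) := fun i => by
      rw [T.isTangent_iff z hz hh]
      exact ⟨Pi.single i 1, fun j => by simp [Pi.single_apply, hr]⟩
    have hr0 : minor r J₁ ≠ 0 := fun h0 => by
      have h1 := hKminor z r hrt T.J₀
      rw [h0, zero_mul] at h1
      have h2 : minor r T.J₀ ≠ 0 := by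
        rw [hr, T.minor_J₀ hz]
        exact pow_ne_zero _ (T.β_ne_zero z hh)
      exact (mul_ne_zero (pow_ne_zero _ hCz) h2) h1
    have h3 : eval (minor r) G = 0 := by
      have := hz _ ((T.mem_ideal_iff d G hG).1 hGY)
      rwa [eval_aeval_minor] at this
    have h4 := eval_mul_of_isHomogeneous hG (minor r J₁) (minor fun i j => eval z (K i j))
    have h5 := eval_mul_of_isHomogeneous hG (eval z C.det ^ (n + 1)) (minor r)
    rw [h3, mul_zero] at h5
    rw [← funext (hKminor z r hrt), h5] at h4
    rw [eval_aeval_minor, (mul_eq_zero.1 h4.symm).resolve_left (pow_ne_zero _ hr0), mul_zero]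
  have hCnot : C.det ∉ X.ideal := fun h => by
    have := hx _ h
    rw [hCx] at this
    exact one_ne_zero this
  have hP : aeval (minor K) G ∈ X.ideal :=
    (X.isPrime.mem_or_mem hmem).resolve_left fun h =>
      (X.isPrime.mem_or_mem h).elim T.h_notMem hCnot
  have h6 := hx _ hP
  rw [eval_aeval_minor] at h6
  have h7 := eval_mul_of_isHomogeneous hG (minor b J₁) (minor fun i j => eval x.rep (K i j))
  rw [h6, mul_zero, ← funext (hKminor x.rep b hbt), hCx] at h7
  simp only [one_pow, one_mul] at h7
  exact h7

theorem zariskiClosure_gaussImage [IsAlgClosed k] (T : GaussChart X Y) :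
    zariskiClosure (X.gaussImage n) = Y.points := by
  apply Set.Subset.antisymm
  · intro y hy
    exact Y.eval_eq_zero_of_isHomogeneous fun d G hG hGY =>
      hy d G hG fun x hx => T.gaussImage_subset hx G hGY
  · intro y hy d G hG hGz
    apply hy
    rw [T.mem_ideal_iff d G hG]
    have hmem : T.h * aeval (minor T.α) G ∈ X.ideal := by
      refine X.mem_ideal_of_forall_points (T.h_hom.mul (T.aeval_minor_isHomogeneous hG))
        fun x hx => ?_
      rw [map_mul]
      by_cases hh : eval x.rep T.h = 0
      · rw [hh, zero_mul]
      have h1 := hGz _ ⟨x, T.gaussMap hx hh⟩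
      obtain ⟨c, hc0, hc⟩ := exists_rep_mk (T.minor_ne_zero hx hh)
      rw [eval_aeval_minor, hc, eval_mul_of_isHomogeneous hG, h1, mul_zero, mul_zero]
    exact (X.isPrime.mem_or_mem hmem).resolve_left T.h_notMem

/-- The pull-back of a fraction by the Gauss map is obtained by inserting the minors of `α`. -/
theorem isGaussPullback (T : GaussChart X Y) {d : ℕ} (a b : homogeneousSubmodule _ k d)
    (hb : (b : MvPolynomial (PluckerIndex n N) k) ∉ Y.ideal)
    (hb' : aeval (minor T.α) (b : MvPolynomial (PluckerIndex n N) k) ∉ X.ideal) :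
    X.IsGaussPullback Y (Y.fraction d a b hb)
      (X.fraction (T.D * (n + 1) * d) ⟨_, T.aeval_minor_isHomogeneous a.2⟩
        ⟨_, T.aeval_minor_isHomogeneous b.2⟩ hb') := by
  refine ⟨_, T.h * aeval (minor T.α) (b : MvPolynomial (PluckerIndex n N) k),
    T.h_hom.mul (T.aeval_minor_isHomogeneous b.2),
    fun h => (X.isPrime.mem_or_mem h).elim T.h_notMem hb', fun x hx hhx => ?_⟩
  rw [map_mul] at hhx
  have hh := left_ne_zero_of_mul hhx
  have hbx := right_ne_zero_of_mul hhx
  set y := Projectivization.mk k _ (T.minor_ne_zero hx hh) with hy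
  obtain ⟨c, hc0, hc⟩ := exists_rep_mk (T.minor_ne_zero hx hh)
  have hev : ∀ G : homogeneousSubmodule (PluckerIndex n N) k d,
      eval x.rep (aeval (minor T.α) (G : MvPolynomial (PluckerIndex n N) k)) =
        c ^ d * eval y.rep (G : MvPolynomial (PluckerIndex n N) k) := fun G => by
    rw [eval_aeval_minor, ← eval_mul_of_isHomogeneous G.2]
    exact congrArg (fun w => eval w (G : MvPolynomial (PluckerIndex n N) k)) hc
  have hby : eval y.rep (b : MvPolynomial (PluckerIndex n N) k) ≠ 0 := by
    rw [hev] at hbx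
    exact right_ne_zero_of_mul hbx
  have hval : X.HasValueAt (X.fraction (T.D * (n + 1) * d) ⟨_, T.aeval_minor_isHomogeneous a.2⟩
      ⟨_, T.aeval_minor_isHomogeneous b.2⟩ hb') x
      (eval y.rep (a : MvPolynomial (PluckerIndex n N) k) /
        eval y.rep (b : MvPolynomial (PluckerIndex n N) k)) := by
    refine ⟨hx, T.D * (n + 1) * d, ⟨_, T.aeval_minor_isHomogeneous a.2⟩,
      ⟨_, T.aeval_minor_isHomogeneous b.2⟩, hb', rfl, hbx, ?_⟩
    change _ = eval x.rep (aeval (minor T.α) (a : MvPolynomial (PluckerIndex n N) k)) /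
      eval x.rep (aeval (minor T.α) (b : MvPolynomial (PluckerIndex n N) k))
    rw [hev, hev, mul_div_mul_left _ _ (pow_ne_zero _ hc0)]
  exact ⟨y, _, T.gaussMap hx hh, ⟨T.mk_minor_mem_points hx hh, d, a, b, hb, rfl, hby, rfl⟩, hval⟩

end GaussChart

end Chart

end ProjVariety

/-! ### The universal subspace at the generic point of a subvariety of the Grassmannian -/

/-- A determinant of arbitrary columns of a matrix is zero or, up to sign, a minor. -/
theorem exists_det_eq_mul_minor {k : Type*} [CommRing k] {n N : ℕ} (J₀ : PluckerIndex n N)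
    (c : Fin (n + 1) → Fin (N + 1)) :
    ∃ (ε : k) (J : PluckerIndex n N), ∀ b : Fin (n + 1) → Fin (N + 1) → k,
      (Matrix.of fun i j => b i (c j)).det = ε * minor b J := by
  by_cases hc : Function.Injective c
  · let s := Tuple.sort c
    have hmono : StrictMono (c ∘ s) :=
      (Tuple.monotone_sort c).strictMono_of_injective (hc.comp s.injective)
    refine ⟨(Equiv.Perm.sign s : ℤ), OrderEmbedding.ofStrictMono _ hmono, fun b => ?_⟩
    have h1 := Matrix.det_permute' s (Matrix.of fun i j => b i (c j))
    have h2 : ((Matrix.of fun i j => b i (c j)).submatrix id s).det =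
        minor b (OrderEmbedding.ofStrictMono _ hmono) := rfl
    rw [← h2, h1, ← mul_assoc, ← Int.cast_mul, ← Units.val_mul, Int.units_mul_self]
    simp
  · rw [Function.Injective] at hc
    push Not at hc
    obtain ⟨i, i', hii', hne⟩ := hc
    refine ⟨0, J₀, fun b => ?_⟩
    rw [zero_mul]
    exact Matrix.det_zero_of_column_eq hne fun l => by simp [hii']

namespace ProjVariety

/-- Over the function field of a subvariety `Y` of the Grassmannian there is a matrix whose minors
are the coordinates of the generic point of `Y`, with a unit matrix in the columns `J₀`. Its
entries are, up to sign, Plücker coordinates by Cramer's rule. -/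
theorem exists_universal_matrix {k : Type u} [Field k] [IsAlgClosed k] {n N : ℕ}
    (Y : ProjVariety k (PluckerIndex n N)) (hY : Y.points ⊆ grassmannian k n N)
    {J₀ : PluckerIndex n N} (hJ₀ : MvPolynomial.X J₀ ∉ Y.ideal) :
    ∃ A : Fin (n + 1) → Fin (N + 1) → Y.FunctionField,
      (∀ i i', A i (J₀ i') = if i = i' then 1 else 0) ∧ ∀ J, minor A J = Y.genericCoord hJ₀ J := by
  choose ε J hεJ using fun (i : Fin (n + 1)) (j : Fin (N + 1)) =>
    exists_det_eq_mul_minor (k := k) J₀ (Function.update J₀ i j)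
  let Λ : Fin (n + 1) → Fin (N + 1) → MvPolynomial (PluckerIndex n N) k :=
    fun i j => C (ε i j) * MvPolynomial.X (J i j)
  have hΛ : ∀ i j, (Λ i j).IsHomogeneous 1 := fun i j => isHomogeneous_C_mul_X _ _
  have hΛb : ∀ (b : Fin (n + 1) → Fin (N + 1) → k) i j,
      eval (minor b) (Λ i j) = (Matrix.cramer (Matrix.of fun l m => b l (J₀ m)) fun l => b l j) i := by
    intro b i j
    simp only [Λ, map_mul, eval_C, eval_X]
    rw [← hεJ, Matrix.cramer_apply]
    congr 1
    ext l m
    simp only [Matrix.of_apply, Matrix.updateCol_apply, Function.update_apply]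
    split_ifs <;> rfl
  -- equations that hold on the Grassmannian hold at the generic point of `Y`
  have hgen : ∀ {d : ℕ} {Q : MvPolynomial (PluckerIndex n N) k}, Q.IsHomogeneous d →
      (∀ b : Fin (n + 1) → Fin (N + 1) → k, eval (minor b) Q = 0) →
        aeval (Y.genericCoord hJ₀) Q = 0 := by
    intro d Q hQ hQb
    rw [← Y.isGenericPoint_genericCoord hJ₀ d Q hQ]
    refine Y.mem_ideal_of_forall_points hQ fun y hy => ?_
    obtain ⟨W, b, hb, rfl⟩ := hY hy
    obtain ⟨c, hc0, hc⟩ := exists_rep_mk hb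
    have h1 : eval (pluckerVector fun i => (b i : Fin (N + 1) → k)) Q = 0 := hQb _
    rw [hc, eval_mul_of_isHomogeneous hQ] at h1
    exact (mul_eq_zero.1 h1).resolve_left (pow_ne_zero _ hc0)
  refine ⟨fun i j => aeval (Y.genericCoord hJ₀) (Λ i j), fun i i' => ?_, fun I => ?_⟩
  · have h := hgen (Q := Λ i (J₀ i') - C (if i = i' then 1 else 0) * MvPolynomial.X J₀)
      ((hΛ _ _).sub (isHomogeneous_C_mul_X _ _)) fun b => by
        simp only [map_sub, map_mul, eval_C, eval_X]
        rw [hΛb, Matrix.cramer_apply, sub_eq_zero]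
        split_ifs with hii
        · subst hii
          rw [one_mul]
          congr 1
          exact Matrix.updateCol_eq_self _ _
        · rw [zero_mul]
          refine Matrix.det_zero_of_column_eq hii fun l => ?_
          rw [Matrix.updateCol_self, Matrix.updateCol_ne (Ne.symm hii)]
          rfl
    rw [map_sub, sub_eq_zero] at h
    change aeval (Y.genericCoord hJ₀) (Λ i (J₀ i')) = _
    rw [h, map_mul, aeval_C, aeval_X, genericCoord_self, mul_one]
    split_ifs <;> simp
  · have h := hgen (Q := MvPolynomial.X J₀ * minor Λ I -
        MvPolynomial.X J₀ ^ (n + 1) * MvPolynomial.X I) (d := 1 + 1 * (n + 1))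
      (((isHomogeneous_X k J₀).mul (minor_isHomogeneous hΛ I)).sub (by
        have hd : 1 + 1 * (n + 1) = n + 1 + 1 := by ring
        rw [hd]
        exact (isHomogeneous_X_pow (R := k) J₀ (n + 1)).mul (isHomogeneous_X k I))) fun b => by
        rw [map_sub, map_mul, map_mul, map_pow, eval_X, eval_X, map_minor, sub_eq_zero]
        have h1 : ∀ i j, ∑ m, (Matrix.of fun l m => b l (J₀ m)) i m * eval (minor b) (Λ m j) =
            minor b J₀ * b i j := fun i j => by
          have h2 := congrFun (Matrix.mulVec_cramer (Matrix.of fun l m => b l (J₀ m))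
            fun l => b l j) i
          simp only [hΛb]
          exact h2
        have h3 := minor_mul (Matrix.of fun l m => b l (J₀ m))
          (fun i j => eval (minor b) (Λ i j)) I
        rw [← minor_smul, ← funext fun i => funext (h1 i), h3]
        rfl
    rw [map_sub, map_mul, map_mul, map_pow, aeval_X, aeval_X, genericCoord_self, one_pow, one_mul,
      one_mul, sub_eq_zero] at h
    rw [← h]
    exact (map_minor (aeval (Y.genericCoord hJ₀) :
      MvPolynomial (PluckerIndex n N) k →ₐ[k] Y.FunctionField).toRingHom Λ I).symm

end ProjVariety

/-! ### Equations and forms with prescribed values at a generic point -/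

/-- An element separable over a field of rational functions satisfies an equation with polynomial
coefficients and with non-vanishing derivative. -/
theorem exists_polynomial_derivative_ne_zero {k L ι : Type*} [Field k] [Field L] [Algebra k L]
    {t : ι → L} {x : L} (hx : IsSeparable (IntermediateField.adjoin k (Set.range t)) x) :
    ∃ Q : Polynomial (MvPolynomial ι k),
      Q.eval₂ (aeval t : MvPolynomial ι k →ₐ[k] L).toRingHom x = 0 ∧
        Q.derivative.eval₂ (aeval t : MvPolynomial ι k →ₐ[k] L).toRingHom x ≠ 0 := by
  set K := IntermediateField.adjoin k (Set.range t) with hK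
  let t' : ι → K := fun i => ⟨t i, IntermediateField.subset_adjoin k _ ⟨i, rfl⟩⟩
  have ht' : IntermediateField.adjoin k (Set.range t') = ⊤ := by
    apply IntermediateField.lift_injective K
    rw [IntermediateField.lift_adjoin, IntermediateField.lift_top, ← Set.range_comp]
    rfl
  have := isFractionRing_range_aeval ht'
  let A := (aeval (R := k) t').range
  obtain ⟨b, hb, hq⟩ := IsLocalization.integerNormalization_spec (nonZeroDivisors A)
    (minpoly K x)
  obtain ⟨Q, hQ⟩ := Polynomial.map_surjective
    (aeval (R := k) t').rangeRestrict.toRingHom (aeval (R := k) t').rangeRestrict_surjective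
    (IsLocalization.integerNormalization (nonZeroDivisors A) (minpoly K x))
  have hb0 : algebraMap A K b ≠ 0 :=
    IsFractionRing.to_map_ne_zero_of_mem_nonZeroDivisors hb
  have hφ : (aeval t : MvPolynomial ι k →ₐ[k] L).toRingHom = ((algebraMap K L).comp
      (algebraMap A K)).comp (aeval (R := k) t').rangeRestrict.toRingHom := by
    ext i
    · simp
    · simp [t', A]
  have hmap : Q.map ((algebraMap A K).comp (aeval (R := k) t').rangeRestrict.toRingHom) =
      Polynomial.C (algebraMap A K b) * minpoly K x := by
    rw [← Polynomial.map_map, hQ, hq, Algebra.smul_def]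
    rfl
  have hev : ∀ P : Polynomial (MvPolynomial ι k),
      P.eval₂ (aeval t : MvPolynomial ι k →ₐ[k] L).toRingHom x = Polynomial.aeval x
        (P.map ((algebraMap A K).comp (aeval (R := k) t').rangeRestrict.toRingHom)) := fun P => by
    rw [Polynomial.aeval_def, Polynomial.eval₂_map, hφ]
    rfl
  refine ⟨Q, ?_, ?_⟩
  · rw [hev, hmap, map_mul, minpoly.aeval, mul_zero]
  · rw [hev, ← Polynomial.derivative_map, hmap, Polynomial.derivative_C_mul, map_mul,
      Polynomial.aeval_C]
    refine mul_ne_zero ?_ (hx.aeval_derivative_ne_zero (minpoly.aeval K x))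
    rwa [Ne, map_eq_zero]

/-- The partial derivatives of a polynomial in one variable `X j` over a polynomial ring. -/
theorem MvPolynomial.pderiv_eval₂_rename {k ι σ : Type*} [CommRing k] [DecidableEq σ] {f : ι → σ}
    (j : σ) {m : σ} (hm : m ∉ Set.range f) (Q : Polynomial (MvPolynomial ι k)) :
    pderiv m (Q.eval₂ (rename f : MvPolynomial ι k →ₐ[k] MvPolynomial σ k).toRingHom (X j)) =
      if m = j then Q.derivative.eval₂
        (rename f : MvPolynomial ι k →ₐ[k] MvPolynomial σ k).toRingHom (X j) else 0 := by
  have h0 : ∀ a : MvPolynomial ι k, pderiv m (rename f a) = 0 := fun a =>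
    pderiv_eq_zero_of_notMem_vars fun h => by
      obtain ⟨i, -, hi⟩ := Finset.mem_image.1 (vars_rename f a h)
      exact hm ⟨i, hi⟩
  induction Q using Polynomial.induction_on' with
  | add P Q hP hQ =>
    rw [Polynomial.eval₂_add, map_add, hP, hQ, Polynomial.derivative_add, Polynomial.eval₂_add]
    split_ifs <;> simp
  | monomial e a =>
    have h1 : (rename f : MvPolynomial ι k →ₐ[k] MvPolynomial σ k).toRingHom a = rename f a := rfl
    have h2 : (rename f : MvPolynomial ι k →ₐ[k] MvPolynomial σ k).toRingHom (a * e) =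
        rename f a * e := by simp
    rw [Polynomial.eval₂_monomial, Polynomial.derivative_monomial, Polynomial.eval₂_monomial,
      h1, h2, pderiv_mul, h0, zero_mul, zero_add, pderiv_pow, pderiv_X]
    split_ifs with h
    · subst h
      rw [Pi.single_eq_same]
      ring
    · rw [Pi.single_eq_of_ne (Ne.symm h)]
      ring

/-- Let `ξ j` be separable over the field generated by the coordinates `ξ (f i)`. Then there is a
form vanishing at `ξ` whose gradient at `ξ`, outside of the coordinates `f i`, is non-zero exactly
at `j`. -/
theorem exists_form_pderiv_eq_zero {k L ι σ : Type*} [Field k] [Field L] [Algebra k L] {f : ι → σ}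
    {ξ : σ → L} {i₀ : ι} (h₀ : ξ (f i₀) = 1) {j : σ} (hj : j ∉ Set.range f)
    (hsep : IsSeparable (IntermediateField.adjoin k (Set.range fun i => ξ (f i))) (ξ j)) :
    ∃ (d : ℕ) (F : MvPolynomial σ k), F.IsHomogeneous d ∧ aeval ξ F = 0 ∧
      aeval ξ (pderiv j F) ≠ 0 ∧ ∀ m ∉ Set.range f, m ≠ j → aeval ξ (pderiv m F) = 0 := by
  classical
  obtain ⟨Q, hQ, hQ'⟩ := exists_polynomial_derivative_ne_zero hsep
  have hne : ∀ m ∉ Set.range f, m ≠ f i₀ := fun m hm h => hm ⟨i₀, h.symm⟩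
  have hev : ∀ P : Polynomial (MvPolynomial ι k),
      aeval ξ (P.eval₂ (rename f : MvPolynomial ι k →ₐ[k] MvPolynomial σ k).toRingHom (X j)) =
        P.eval₂ (aeval fun i => ξ (f i) : MvPolynomial ι k →ₐ[k] L).toRingHom (ξ j) := fun P => by
    have h1 := Polynomial.hom_eval₂ P (rename f : MvPolynomial ι k →ₐ[k] MvPolynomial σ k).toRingHom
      (aeval ξ : MvPolynomial σ k →ₐ[k] L).toRingHom (X j)
    refine h1.trans ?_
    congr 1
    · ext i
      · simp
      · simp
    · simp
  refine ⟨_, _, isHomogeneous_homogenization (f i₀)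
    (Q.eval₂ (rename f : MvPolynomial ι k →ₐ[k] MvPolynomial σ k).toRingHom (X j)), ?_, ?_, ?_⟩
  · rw [aeval_homogenization h₀, hev, hQ]
  · rw [aeval_pderiv_homogenization (hne j hj) h₀, pderiv_eval₂_rename j hj, if_pos rfl, hev]
    exact hQ'
  · intro m hm hmj
    rw [aeval_pderiv_homogenization (hne m hm) h₀, pderiv_eval₂_rename j hm, if_neg hmj, map_zero]

/-- The chain rule. -/
theorem D_aeval_eq_sum {k L σ : Type*} [CommRing k] [CommRing L] [Algebra k L] [Fintype σ]
    (ξ : σ → L) (F : MvPolynomial σ k) :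
    KaehlerDifferential.D k L (aeval ξ F) =
      ∑ j, aeval ξ (pderiv j F) • KaehlerDifferential.D k L (ξ j) := by
  classical
  induction F using MvPolynomial.induction_on with
  | C a => simp
  | add F G hF hG => simp only [map_add, hF, hG, add_smul, Finset.sum_add_distrib]
  | mul_X F i hF =>
    simp only [map_mul, aeval_X, Derivation.leibniz, hF, map_add, add_smul,
      Finset.sum_add_distrib, pderiv_X, Finset.smul_sum, smul_eq_mul, smul_smul]
    congr 1
    rw [Finset.sum_eq_single i, Pi.single_eq_same, map_one, mul_one]
    · intro j _ hj
      rw [Pi.single_eq_of_ne (Ne.symm hj), map_zero, mul_zero, zero_smul]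
    · exact fun h => absurd (Finset.mem_univ i) h

/-- Finitely many elements of a field generated by `ξ` are values of fractions of forms with a
common denominator. -/
theorem exists_common_denominator {k L σ κ : Type*} [Field k] [Field L] [Algebra k L] [Finite κ]
    {ξ : σ → L} {j₀ : σ} (h₀ : ξ j₀ = 1) (hξ : IntermediateField.adjoin k (Set.range ξ) = ⊤)
    (a : κ → L) :
    ∃ (D : ℕ) (α : κ → MvPolynomial σ k) (β : MvPolynomial σ k), (∀ i, (α i).IsHomogeneous D) ∧
      β.IsHomogeneous D ∧ aeval ξ β ≠ 0 ∧ ∀ i, aeval ξ (α i) = aeval ξ β * a i := by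
  have := Fintype.ofFinite κ
  have := isFractionRing_range_aeval hξ
  obtain ⟨⟨⟨_, b, rfl⟩, hb⟩, hba⟩ := IsLocalization.exist_integer_multiples_of_finite
    (nonZeroDivisors (aeval (R := k) ξ).range) a
  have hb0 : aeval ξ b ≠ 0 := fun h => nonZeroDivisors.ne_zero hb (Subtype.ext h)
  choose c hc using hba
  choose g hg using fun i => (c i).2
  have hga : ∀ i, aeval ξ (g i) = aeval ξ b * a i := fun i => (hg i).trans (hc i)
  -- pass to forms of the same degree
  let D := max b.totalDegree (Finset.univ.sup fun i => (g i).totalDegree)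
  let H : MvPolynomial σ k → MvPolynomial σ k := fun G =>
    X j₀ ^ (D - G.totalDegree) * homogenization j₀ G
  have hH : ∀ G, G.totalDegree ≤ D → (H G).IsHomogeneous D := fun G hG => by
    have := (isHomogeneous_X_pow (R := k) j₀ (D - G.totalDegree)).mul
      (isHomogeneous_homogenization j₀ G)
    rwa [Nat.sub_add_cancel hG] at this
  have hHξ : ∀ G, aeval ξ (H G) = aeval ξ G := fun G => by
    rw [map_mul, map_pow, aeval_X, h₀, one_pow, one_mul, aeval_homogenization h₀]
  refine ⟨D, fun i => H (g i), H b, fun i => hH _ ?_, hH _ (le_max_left _ _), ?_, fun i => ?_⟩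
  · exact le_max_of_le_right
      (Finset.le_sup (f := fun i => (g i).totalDegree) (Finset.mem_univ i))
  · rwa [hHξ]
  · rw [hHξ, hHξ, hga]

namespace ProjVariety

/-! ### The variety with given tangent spaces -/

section Construction

variable {k : Type u} [Field k] {n N : ℕ}

/-- The rows of the matrix `A` are tangent to the cone over `X` at its generic point `ξ = t * A`
if the entries of `A` are killed by the universal derivation: differentiating an equation `F` at `ξ`
gives a linear relation between the linearly independent differentials of the `t i`, and a last
relation is Euler's formula. -/
theorem sum_pderiv_mul_eq_zero {L : Type v} [Field L] [Algebra k L]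
    {A : Fin (n + 1) → Fin (N + 1) → L} (hA : ∀ i j, KaehlerDifferential.D k L (A i j) = 0)
    {t : Fin (n + 1) → L} {i₀ : Fin (n + 1)} (ht₀ : t i₀ = 1)
    (ht : LinearIndependent L fun i : {i // i ≠ i₀} => KaehlerDifferential.D k L (t i))
    {d : ℕ} {F : MvPolynomial (Fin (N + 1)) k} (hF : F.IsHomogeneous d)
    (hF0 : aeval (fun j => ∑ i, t i * A i j) F = 0) (i : Fin (n + 1)) :
    ∑ j, aeval (fun j => ∑ i, t i * A i j) (pderiv j F) * A i j = 0 := by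
  set ξ : Fin (N + 1) → L := fun j => ∑ i, t i * A i j with hξ
  set c : Fin (n + 1) → L := fun i => ∑ j, aeval ξ (pderiv j F) * A i j with hc
  have hDξ : ∀ j, KaehlerDifferential.D k L (ξ j) =
      ∑ i : {i // i ≠ i₀}, A i j • KaehlerDifferential.D k L (t i) := fun j => by
    simp only [hξ, map_sum, Derivation.leibniz, hA, smul_zero, zero_add]
    rw [← Fintype.sum_subtype_add_sum_subtype (fun i => i ≠ i₀)]
    refine add_eq_left.2 (Finset.sum_eq_zero fun i _ => ?_)
    rw [not_not.1 i.2, ht₀, Derivation.map_one_eq_zero, smul_zero]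
  have hc0 : ∀ i, i ≠ i₀ → c i = 0 := fun i hi => by
    have h1 := D_aeval_eq_sum ξ F
    rw [hF0, map_zero] at h1
    simp only [hDξ, Finset.smul_sum, smul_smul] at h1
    rw [Finset.sum_comm] at h1
    simp only [← Finset.sum_smul] at h1
    exact (Fintype.linearIndependent_iff.1 ht) (fun i => c i) h1.symm ⟨i, hi⟩
  by_cases hi : i = i₀
  · have h1 := congrArg (aeval ξ) hF.sum_X_mul_pderiv
    rw [map_nsmul, hF0, smul_zero, map_sum] at h1
    simp only [map_mul, aeval_X] at h1
    have h2 : ∑ i, t i * c i = 0 := by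
      rw [← h1]
      simp only [hc, Finset.mul_sum]
      rw [Finset.sum_comm]
      refine Finset.sum_congr rfl fun j _ => ?_
      simp only [hξ, Finset.sum_mul]
      exact Finset.sum_congr rfl fun i _ => by ring
    rw [Finset.sum_eq_single i₀ (fun i _ hi => by rw [hc0 i hi, mul_zero])
      (fun h => absurd (Finset.mem_univ _) h), ht₀, one_mul, ← hi] at h2
    exact h2
  · exact hc0 i hi

theorem aeval_aeval_minor {L : Type v} [Field L] [Algebra k L] {σ : Type} {ξ : σ → L}
    {α : Fin (n + 1) → Fin (N + 1) → MvPolynomial σ k} {A : Fin (n + 1) → Fin (N + 1) → L} {b : L}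
    (hα : ∀ i j, aeval ξ (α i j) = b * A i j) {d : ℕ} {G : MvPolynomial (PluckerIndex n N) k}
    (hG : G.IsHomogeneous d) :
    aeval ξ (aeval (minor α) G) = (b ^ (n + 1)) ^ d * aeval (minor A) G := by
  rw [comp_aeval_apply, ← aeval_mul_of_isHomogeneous hG]
  congr 2
  funext J
  rw [← minor_smul, ← funext fun i => funext (hα i)]
  exact map_minor (aeval ξ : MvPolynomial σ k →ₐ[k] L).toRingHom α J

/-- If the variety `X` has the generic point `t * A`, where `A` is a matrix of rational functions
killed by the universal derivation, and the minors of `A` form a generic point of `Y`, then the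
Gauss map of `X` is given by the minors of `A`. -/
theorem exists_gaussChart {L : Type v} [Field L] [Algebra k L]
    {Y : ProjVariety k (PluckerIndex n N)} {J₀ : PluckerIndex n N}
    {A : Fin (n + 1) → Fin (N + 1) → L} (hA : ∀ i j, KaehlerDifferential.D k L (A i j) = 0)
    (hAJ : ∀ i i', A i (J₀ i') = if i = i' then 1 else 0) (hAY : Y.IsGenericPoint (minor A))
    {t : Fin (n + 1) → L} {i₀ : Fin (n + 1)} (ht₀ : t i₀ = 1)
    (ht : LinearIndependent L fun i : {i // i ≠ i₀} => KaehlerDifferential.D k L (t i))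
    [Algebra.IsSeparable (IntermediateField.adjoin k (Set.range t)) L]
    {X : ProjVariety k (Fin (N + 1))} (hX : X.IsGenericPoint fun j => ∑ i, t i * A i j)
    (hdim : X.dim = n)
    (hgen : IntermediateField.adjoin k (Set.range fun j => ∑ i, t i * A i j) = ⊤) :
    ∃ (T : GaussChart X Y) (b : L), b ≠ 0 ∧
      ∀ i j, aeval (fun j => ∑ i, t i * A i j) (T.α i j) = b * A i j := by
  set ξ : Fin (N + 1) → L := fun j => ∑ i, t i * A i j with hξ
  have hξJ : ∀ i, ξ (J₀ i) = t i := fun i => by simp [hξ, hAJ]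
  have h₀ : ξ (J₀ i₀) = 1 := by rw [hξJ, ht₀]
  obtain ⟨D, α', β, hα', hβ, hβ0, hαβ'⟩ := exists_common_denominator h₀ hgen
    fun q : Fin (n + 1) × Fin (N + 1) => A q.1 q.2
  let α : Fin (n + 1) → Fin (N + 1) → MvPolynomial (Fin (N + 1)) k := fun i j => α' (i, j)
  have hα : ∀ i j, (α i j).IsHomogeneous D := fun i j => hα' _
  have hαβ : ∀ i j, aeval ξ (α i j) = aeval ξ β * A i j := fun i j => hαβ' _
  have hsep : ∀ j, IsSeparable (IntermediateField.adjoin k (Set.range fun i => ξ (J₀ i))) (ξ j) := by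
    rw [funext hξJ]
    exact fun j => Algebra.IsSeparable.isSeparable _ _
  choose d F hFd hF0 hFj hFm using fun j : {m // m ∉ Set.range J₀} =>
    exists_form_pderiv_eq_zero h₀ j.2 (hsep j)
  let h := β * ∏ j : {m // m ∉ Set.range J₀}, pderiv (j : Fin (N + 1)) (F j)
  have hh : h.IsHomogeneous (D + ∑ j, (d j - 1)) :=
    hβ.mul (IsHomogeneous.prod _ _ _ fun j _ => (hFd j).pderiv)
  -- the rows of `α` are tangent vectors
  have hrow : ∀ z : Fin (N + 1) → k, (∀ G ∈ X.ideal, eval z G = 0) → ∀ i,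
      X.IsTangent z fun j => eval z (α i j) := fun z hz i G hG => by
    have hcomp : ∀ e, ∑ j, eval z (pderiv j (homogeneousComponent e G)) * eval z (α i j) = 0 := by
      intro e
      have hG' := X.homogeneousComponent_mem_ideal hG e
      have hGe := homogeneousComponent_isHomogeneous e G
      have hP : (∑ j, pderiv j (homogeneousComponent e G) * α i j).IsHomogeneous (e - 1 + D) :=
        IsHomogeneous.sum _ _ _ fun j _ => hGe.pderiv.mul (hα i j)
      have h1 : ∑ j, pderiv j (homogeneousComponent e G) * α i j ∈ X.ideal := by
        rw [hX _ _ hP, map_sum]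
        have h2 := sum_pderiv_mul_eq_zero hA ht₀ ht hGe ((hX _ _ hGe).1 hG') i
        rw [← mul_zero (aeval ξ β), ← h2, Finset.mul_sum]
        refine Finset.sum_congr rfl fun j _ => ?_
        rw [map_mul, hαβ]
        ring
      have h2 := hz _ h1
      simpa only [map_sum, map_mul] using h2
    conv_lhs => rw [← sum_homogeneousComponent G]
    simp only [map_sum, Finset.sum_mul]
    rw [Finset.sum_comm]
    exact Finset.sum_eq_zero fun e _ => hcomp e
  have hαJ : ∀ z : Fin (N + 1) → k, (∀ G ∈ X.ideal, eval z G = 0) → ∀ i i',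
      eval z (α i (J₀ i')) = if i = i' then eval z β else 0 := fun z hz i i' => by
    have h1 : α i (J₀ i') - C (if i = i' then 1 else 0) * β ∈ X.ideal := by
      rw [hX _ _ ((hα _ _).sub (hβ.C_mul _)), map_sub, map_mul, hαβ, hAJ, aeval_C]
      split_ifs <;> simp
    have h2 := hz _ h1
    rw [map_sub, map_mul, eval_C, sub_eq_zero] at h2
    rw [h2]
    split_ifs <;> simp
  have hhβ : ∀ z : Fin (N + 1) → k, eval z h ≠ 0 → eval z β ≠ 0 := fun z hz => by
    rw [map_mul] at hz
    exact left_ne_zero_of_mul hz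
  refine ⟨{
    J₀ := J₀
    D := D
    α := α
    β := β
    e := _
    h := h
    dim_eq := hdim
    α_hom := hα
    h_hom := hh
    h_notMem := ?_
    β_ne_zero := hhβ
    α_J₀ := hαJ
    isTangent_iff := fun z hz hhz v => ⟨fun hv => ?_, ?_⟩
    mem_ideal_iff := fun e G hG => ?_ }, _, hβ0, hαβ⟩
  · rw [hX _ _ hh, map_mul, map_prod]
    exact mul_ne_zero hβ0 (Finset.prod_ne_zero_iff.2 fun j _ => hFj j)
  · -- subtract the combination of the rows with the same entries in the columns `J₀`
    have hβz := hhβ z hhz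
    refine ⟨fun i => v (J₀ i) / eval z β, ?_⟩
    let w : Fin (N + 1) → k := fun j => v j - ∑ i, v (J₀ i) / eval z β * eval z (α i j)
    have hw : X.IsTangent z w := fun G hG => by
      have h1 : ∀ i, ∑ j, eval z (pderiv j G) * eval z (α i j) = 0 := fun i => hrow z hz i G hG
      simp only [w, mul_sub, Finset.sum_sub_distrib, hv G hG, Finset.mul_sum, zero_sub,
        neg_eq_zero]
      rw [Finset.sum_comm]
      refine Finset.sum_eq_zero fun i _ => ?_
      rw [← mul_zero (v (J₀ i) / eval z β), ← h1 i, Finset.mul_sum]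
      exact Finset.sum_congr rfl fun j _ => by ring
    have hwJ : ∀ i, w (J₀ i) = 0 := fun i => by
      simp only [w, hαJ z hz, mul_ite, mul_zero, Finset.sum_ite_eq', Finset.mem_univ, if_true]
      rw [div_mul_cancel₀ _ hβz, sub_self]
    have hw0 : ∀ j, w j = 0 := fun j => by
      by_cases hj : j ∈ Set.range J₀
      · obtain ⟨i, rfl⟩ := hj
        exact hwJ i
      · have h1 := hw _ ((hX _ _ (hFd ⟨j, hj⟩)).2 (hF0 ⟨j, hj⟩))
        rw [Finset.sum_eq_single j] at h1
        · refine (mul_eq_zero.1 h1).resolve_left ?_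
          rw [map_mul, map_prod] at hhz
          exact Finset.prod_ne_zero_iff.1 (right_ne_zero_of_mul hhz) ⟨j, hj⟩ (Finset.mem_univ _)
        · intro m _ hmj
          by_cases hm : m ∈ Set.range J₀
          · obtain ⟨i, rfl⟩ := hm
            rw [hwJ, mul_zero]
          · rw [hz _ ((hX _ _ (hFd ⟨j, hj⟩).pderiv).2 (hFm ⟨j, hj⟩ m hm hmj)), zero_mul]
        · exact fun h => absurd (Finset.mem_univ j) h
    exact fun j => sub_eq_zero.1 (hw0 j)
  · rintro ⟨c, hc⟩ G hG
    have h1 : ∀ i, ∑ j, eval z (pderiv j G) * eval z (α i j) = 0 := fun i => hrow z hz i G hG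
    simp only [hc, Finset.mul_sum]
    rw [Finset.sum_comm]
    refine Finset.sum_eq_zero fun i _ => ?_
    rw [← mul_zero (c i), ← h1 i, Finset.mul_sum]
    exact Finset.sum_congr rfl fun j _ => by ring
  · have h1 : (aeval (minor α) G).IsHomogeneous (D * (n + 1) * e) :=
      hG.aeval _ fun J => minor_isHomogeneous hα J
    rw [hX _ _ h1, hAY _ _ hG, aeval_aeval_minor hαβ hG, mul_eq_zero,
      or_iff_right (pow_ne_zero _ (pow_ne_zero _ hβ0))]

end Construction

end ProjVariety

namespace ProjVariety

section Existence

variable {k : Type u} [Field k] {n N : ℕ}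

/-- A matrix with entries in the function field whose minors are the coordinates of the generic point
of a variety of positive dimension has an entry that is not constant. -/
theorem exists_transcendental_entry {Y : ProjVariety k (PluckerIndex n N)} (hY : 1 ≤ Y.dim)
    {J₀ : PluckerIndex n N} (hJ₀ : MvPolynomial.X J₀ ∉ Y.ideal)
    {A : Fin (n + 1) → Fin (N + 1) → Y.FunctionField}
    (hA : ∀ J, minor A J = Y.genericCoord hJ₀ J) : ∃ i j, Transcendental k (A i j) := by
  by_contra! h
  have h1 : ∀ i j, IsIntegral k (A i j) := fun i j => by
    have := h i j
    rw [Transcendental, not_not] at this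
    exact this.isIntegral
  have h2 : ∀ y ∈ Set.range (Y.genericCoord hJ₀), IsIntegral k y := by
    rintro _ ⟨J, rfl⟩
    rw [← hA]
    exact IsIntegral.det fun i j => h1 _ _
  have h3 := IntermediateField.isAlgebraic_adjoin h2
  rw [Y.adjoin_genericCoord] at h3
  have h4 : Algebra.IsAlgebraic k Y.FunctionField :=
    IntermediateField.topEquiv.isAlgebraic
  rw [dim, trdeg_eq_zero] at hY
  exact absurd hY (by simp)

/-- A function field `L` of transcendence degree `n` in which the differentials of `K(Y)` vanish is
the function field of a variety whose Gauss image has the closure `Y`. The generic point is `s c * A`,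
where `s c` consists of `1` and the elements `t i`, and the constant `c` is added to the one in the
row of a non-constant entry of `A`. -/
theorem exists_projVariety_gaussMap [IsAlgClosed k] (p : ℕ) [Fact p.Prime] [CharP k p]
    (Y : ProjVariety k (PluckerIndex n N)) (hY : Y.points ⊆ grassmannian k n N)
    (hY1 : 1 ≤ Y.dim) (hYn : Y.dim ≤ (n : Cardinal.{u}))
    (L : Type v) [Field L] [Algebra k L] [Algebra Y.FunctionField L]
    [IsScalarTower k Y.FunctionField L] (hL : (⊤ : IntermediateField k L).FG)
    (hLn : Algebra.trdeg k L = (n : Cardinal.{v}))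
    (hδ : KaehlerDifferential.mapBaseChange k Y.FunctionField L = 0) :
    ∃ X : ProjVariety k (Fin (N + 1)),
      X.dim = (n : Cardinal.{u}) ∧
      zariskiClosure (X.gaussImage n) = Y.points ∧
      ∃ e : X.FunctionField ≃ₐ[k] L, ∀ f : Y.FunctionField,
        X.IsGaussPullback Y f (e.symm (algebraMap Y.FunctionField L f)) := by
  classical
  have : Algebra.EssFiniteType k L := IntermediateField.fg_top_iff.1 hL
  obtain ⟨J₀, hJ₀⟩ := Y.exists_X_notMem
  obtain ⟨B, hBJ, hBminor⟩ := Y.exists_universal_matrix hY hJ₀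
  obtain ⟨i₁, j₁, htr⟩ := exists_transcendental_entry hY1 hJ₀ hBminor
  have hn : 1 ≤ n := by exact_mod_cast hY1.trans hYn
  have : Nontrivial (Fin (n + 1)) := Fin.nontrivial_iff_two_le.2 (by omega)
  obtain ⟨i₀, hi₀⟩ := exists_ne i₁
  let A : Fin (n + 1) → Fin (N + 1) → L := fun i j => algebraMap Y.FunctionField L (B i j)
  have hA : ∀ i j, KaehlerDifferential.D k L (A i j) = 0 := fun i j => by
    have h1 := LinearMap.congr_fun hδ
      ((1 : L) ⊗ₜ[Y.FunctionField] KaehlerDifferential.D k Y.FunctionField (B i j))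
    rw [KaehlerDifferential.mapBaseChange_tmul, one_smul, KaehlerDifferential.map_D] at h1
    exact h1
  have hAJ : ∀ i i', A i (J₀ i') = if i = i' then 1 else 0 := fun i i' => by
    simp only [A, hBJ]
    split_ifs <;> simp
  have hAminor : minor A = fun J => algebraMap Y.FunctionField L (Y.genericCoord hJ₀ J) := by
    funext J
    rw [← hBminor, map_minor]
  have hAev : ∀ G : MvPolynomial (PluckerIndex n N) k, aeval (minor A) G =
      algebraMap Y.FunctionField L (aeval (Y.genericCoord hJ₀) G) := fun G => by
    rw [hAminor]
    exact aeval_algebraMap_apply L (Y.genericCoord hJ₀) G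
  have hAY : Y.IsGenericPoint (minor A) := fun d G hG => by
    rw [hAev, map_eq_zero]
    exact Y.isGenericPoint_genericCoord hJ₀ d G hG
  have hcard : Algebra.trdeg k L = Fintype.card {i : Fin (n + 1) // i ≠ i₀} := by
    rw [hLn, Fintype.card_subtype_compl]
    simp
  obtain ⟨t, b, hb, ht⟩ := exists_adjoin_insert_eq_top p hcard
    (a := A i₁ j₁) ((transcendental_algebraMap_iff (algebraMap Y.FunctionField L).injective).2 htr)
  have hsep₀ : Algebra.IsSeparable (IntermediateField.adjoin k (Set.range t)) L := by
    apply isSeparable_adjoin_of_span_D_eq_top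
    rw [← funext hb]
    exact b.span_eq
  -- the pencil `s c`, which moves the coordinate `j₁` of `s c * A` by `c • A i₁ j₁`
  let s : k → Fin (n + 1) → L := fun c i =>
    (if h : i ≠ i₀ then t ⟨i, h⟩ else 1) + if i = i₁ then algebraMap k L c else 0
  obtain ⟨c, hc⟩ := exists_adjoin_insert_add_smul_eq_top ht (∑ i, s 0 i * A i j₁)
  have hs₀ : s c i₀ = 1 := by simp [s, hi₀]
  have hs : ∀ i : {i // i ≠ i₀}, s c i = t i + algebraMap k L (if (i : Fin (n + 1)) = i₁ then c else 0) :=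
    fun i => by
      simp only [s, dif_pos i.2]
      split_ifs <;> simp
  have hDs : (fun i : {i // i ≠ i₀} => KaehlerDifferential.D k L (s c i)) = b := by
    funext i
    rw [hs, map_add, Derivation.map_algebraMap, add_zero, hb]
  have hli : LinearIndependent L fun i : {i // i ≠ i₀} => KaehlerDifferential.D k L (s c i) := by
    rw [hDs]
    exact b.linearIndependent
  have hsep : Algebra.IsSeparable (IntermediateField.adjoin k (Set.range (s c))) L := by
    apply isSeparable_adjoin_of_span_D_eq_top
    rw [eq_top_iff, ← b.span_eq, ← hDs]
    apply Submodule.span_mono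
    rintro _ ⟨i, rfl⟩
    exact ⟨i, rfl⟩
  set ξ : Fin (N + 1) → L := fun j => ∑ i, s c i * A i j with hξ
  have hξJ : ∀ i, ξ (J₀ i) = s c i := fun i => by simp [hξ, hAJ]
  have hgen : IntermediateField.adjoin k (Set.range ξ) = ⊤ := by
    rw [eq_top_iff, ← hc, IntermediateField.adjoin_le_iff]
    rintro _ (rfl | ⟨i, rfl⟩)
    · apply IntermediateField.subset_adjoin
      refine ⟨j₁, ?_⟩
      have h1 : ∀ i, s c i * A i j₁ = s 0 i * A i j₁ + if i = i₁ then c • A i j₁ else 0 := fun i => by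
        simp only [s, map_zero, ite_self, add_zero, add_mul, Algebra.smul_def]
        split_ifs <;> simp
      simp only [hξ, h1, Finset.sum_add_distrib, Finset.sum_ite_eq', Finset.mem_univ, if_true]
    · have h1 : t i = ξ (J₀ i) - algebraMap k L (if (i : Fin (n + 1)) = i₁ then c else 0) := by
        rw [hξJ, hs, add_sub_cancel_right]
      rw [h1]
      exact sub_mem (IntermediateField.subset_adjoin _ _ ⟨_, rfl⟩)
        (IntermediateField.algebraMap_mem _ _)
  have hξ₀ : ξ (J₀ i₀) = 1 := by rw [hξJ, hs₀]
  obtain ⟨X, hX⟩ := exists_isGenericPoint (k := k) ξ hξ₀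
  obtain ⟨e, he⟩ := hX.exists_algEquiv hξ₀ hgen
  have hdim : X.dim = (n : Cardinal.{u}) := by
    have h1 := e.lift_trdeg_eq
    rw [hLn, Cardinal.lift_natCast] at h1
    exact Cardinal.lift_eq_nat_iff.1 h1
  obtain ⟨T, c', hc', hT⟩ := exists_gaussChart hA hAJ hAY hs₀ hli hX hdim hgen
  refine ⟨X, hdim, T.zariskiClosure_gaussImage, e, fun f => ?_⟩
  obtain ⟨d, P, Q, hQ, rfl⟩ := Y.exists_eq_fraction f
  have hQ' : aeval (minor T.α) (Q : MvPolynomial (PluckerIndex n N) k) ∉ X.ideal :=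
    fun h => hQ ((T.mem_ideal_iff d _ Q.2).2 h)
  convert T.isGaussPullback P Q hQ hQ' using 1
  rw [AlgEquiv.symm_apply_eq, he]
  change _ = aeval ξ (aeval (minor T.α) (P : MvPolynomial (PluckerIndex n N) k)) /
    aeval ξ (aeval (minor T.α) (Q : MvPolynomial (PluckerIndex n N) k))
  rw [aeval_aeval_minor hT P.2, aeval_aeval_minor hT Q.2,
    mul_div_mul_left _ _ (pow_ne_zero _ (pow_ne_zero _ hc')), hAev, hAev, ← map_div₀,
    fraction_eq_div Y hJ₀]

end Existence

end ProjVariety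

/-! ### Purely inseparable extensions of the function field -/

/-- An algebraically closed field of given transcendence degree over `K`. -/
theorem exists_isAlgClosed_isTranscendenceBasis (k K : Type u) [Field k] [Field K] [Algebra k K]
    (m : ℕ) :
    ∃ (Ω : Type u) (_ : Field Ω) (_ : IsAlgClosed Ω) (_ : Algebra k Ω) (_ : Algebra K Ω)
      (_ : IsScalarTower k K Ω) (x : Fin m → Ω), IsTranscendenceBasis K x := by
  let R := MvPolynomial (Fin m) K
  have h1 : IsTranscendenceBasis K (MvPolynomial.X : Fin m → R) := .mvPolynomial _ _
  have : Algebra.IsAlgebraic R (FractionRing R) :=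
    IsLocalization.isAlgebraic (FractionRing R) (nonZeroDivisors R)
  have h2 := h1.algebraMap_comp (A := FractionRing R)
  exact ⟨AlgebraicClosure (FractionRing R), inferInstance, inferInstance, inferInstance,
    inferInstance, inferInstance, _, h2.algebraMap_comp (A := AlgebraicClosure (FractionRing R))⟩

/-- A subfield of `Ω` that contains `K` and a transcendence basis over `K` has the same transcendence
degree as `Ω`. -/
theorem trdeg_eq_of_isTranscendenceBasis {k K Ω ι : Type*} [Field k] [Field K] [Field Ω]
    [Algebra k K] [Algebra k Ω] [Algebra K Ω] {x : ι → Ω} (hx : IsTranscendenceBasis K x)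
    (L : IntermediateField k Ω) (hK : ∀ f : K, algebraMap K Ω f ∈ L) (hxL : ∀ i, x i ∈ L) :
    Algebra.trdeg k L = Algebra.trdeg k Ω := by
  have hA : ∀ z ∈ Algebra.adjoin K (Set.range x), z ∈ L := fun z hz => by
    induction hz using Algebra.adjoin_induction with
    | mem z hz => obtain ⟨i, rfl⟩ := hz; exact hxL i
    | algebraMap f => exact hK f
    | add a b _ _ ha hb => exact add_mem ha hb
    | mul a b _ _ ha hb => exact mul_mem ha hb
  have halg : Algebra.IsAlgebraic (Algebra.adjoin K (Set.range x)) Ω := hx.isAlgebraic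
  let _ : Algebra (Algebra.adjoin K (Set.range x)) L :=
    ((algebraMap (Algebra.adjoin K (Set.range x)) Ω).codRestrict L fun z => hA z z.2).toAlgebra
  have : IsScalarTower (Algebra.adjoin K (Set.range x)) L Ω :=
    IsScalarTower.of_algebraMap_eq fun _ => rfl
  have : Algebra.IsAlgebraic L Ω :=
    Algebra.IsAlgebraic.extendScalars (R := Algebra.adjoin K (Set.range x)) fun a b hab =>
      Subtype.ext (congrArg (Subtype.val : L → Ω) hab)
  have h1 := trdeg_add_eq k L (A := Ω)
  rwa [trdeg_eq_zero (R := L), add_zero] at h1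

/-- A function field `K` over `k` of transcendence degree at most `n` has an extension `L`, a function
field over `k` of transcendence degree `n`, in which all elements of `K` are `p ^ e`-th powers. It is
generated over `k` by independent variables and by the `p ^ e`-th roots of generators of `K`. -/
theorem exists_extension_forall_exists_pow_eq {k K : Type u} [Field k] [IsAlgClosed k] [Field K]
    [Algebra k K] [Algebra.EssFiniteType k K] (p : ℕ) [Fact p.Prime] [CharP k p] {n : ℕ}
    (hn : Algebra.trdeg k K ≤ n) (e : ℕ) :
    ∃ (L : Type u) (_ : Field L) (_ : Algebra k L) (_ : Algebra K L) (_ : IsScalarTower k K L),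
      (⊤ : IntermediateField k L).FG ∧ Algebra.trdeg k L = n ∧
        ∀ f : K, ∃ h : L, h ^ p ^ e = algebraMap K L f := by
  obtain ⟨r, hr⟩ := Cardinal.lt_aleph0.1 (hn.trans_lt Cardinal.natCast_lt_aleph0)
  rw [hr, Nat.cast_le] at hn
  obtain ⟨Ω, _, _, _, _, _, x, hx⟩ := exists_isAlgClosed_isTranscendenceBasis k K (n - r)
  have : CharP Ω p := charP_of_injective_algebraMap (algebraMap k Ω).injective p
  have : ExpChar Ω p := ExpChar.prime Fact.out
  let φ : Ω ≃+* Ω := iterateFrobeniusEquiv Ω p e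
  have hφ : ∀ z, φ.symm z ^ p ^ e = z := fun z => by
    have := φ.apply_symm_apply z
    rwa [iterateFrobeniusEquiv_apply, iterateFrobenius_def] at this
  obtain ⟨s, hs⟩ := (IntermediateField.fg_top_iff (F := k) (E := K)).2 inferInstance
  set G : Set Ω := Set.range x ∪ (fun f => φ.symm (algebraMap K Ω f)) '' (s : Set K) with hG
  set L := IntermediateField.adjoin k G with hL
  have hroot : ∀ f : K, φ.symm (algebraMap K Ω f) ∈ L := fun f => by
    have hf : f ∈ IntermediateField.adjoin k (s : Set K) := hs ▸ IntermediateField.mem_top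
    induction hf using IntermediateField.adjoin_induction with
    | mem f hf => exact IntermediateField.subset_adjoin _ _ (Or.inr ⟨f, hf, rfl⟩)
    | algebraMap c =>
      obtain ⟨c, rfl⟩ := IsAlgClosed.exists_pow_nat_eq c (pow_pos (Fact.out : p.Prime).pos e)
      have h1 : φ.symm (algebraMap K Ω (algebraMap k K (c ^ p ^ e))) = algebraMap k Ω c := by
        rw [RingEquiv.symm_apply_eq, iterateFrobeniusEquiv_apply, iterateFrobenius_def,
          ← IsScalarTower.algebraMap_apply, map_pow]
      rw [h1]
      exact L.algebraMap_mem c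
    | add f g _ _ hf hg => rw [map_add, map_add]; exact add_mem hf hg
    | mul f g _ _ hf hg => rw [map_mul, map_mul]; exact mul_mem hf hg
    | inv f _ hf => rw [map_inv₀, map_inv₀]; exact inv_mem hf
  have hK : ∀ f : K, algebraMap K Ω f ∈ L := fun f => by
    rw [← hφ (algebraMap K Ω f)]
    exact pow_mem (hroot f) _
  let _ : Algebra K L := ((algebraMap K Ω).codRestrict L hK).toAlgebra
  have : IsScalarTower k K L := IsScalarTower.of_algebraMap_eq fun c => Subtype.ext
    (IsScalarTower.algebraMap_apply k K Ω c)
  refine ⟨L, inferInstance, inferInstance, inferInstance, inferInstance, ?_, ?_, fun f =>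
    ⟨⟨_, hroot f⟩, Subtype.ext (hφ _)⟩⟩
  · rw [IntermediateField.fg_top_iff, IntermediateField.essFiniteType_iff]
    exact IntermediateField.fg_adjoin_of_finite
      ((Set.finite_range x).union (s.finite_toSet.image _))
  · have h1 := hx.lift_cardinalMk_eq_trdeg
    rw [Cardinal.mk_fin, Cardinal.lift_natCast, Cardinal.lift_id'.{0, u}] at h1
    rw [trdeg_eq_of_isTranscendenceBasis hx L hK fun i =>
      IntermediateField.subset_adjoin _ _ (Or.inl ⟨i, rfl⟩), ← trdeg_add_eq k K (A := Ω), hr, ← h1,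
      ← Nat.cast_add, Nat.add_sub_cancel' hn]

/-- The map of differentials vanishes if the elements of `K` become `p`-th powers in `L`. -/
theorem mapBaseChange_eq_zero {k K L : Type*} [Field k] [Field K] [Field L] [Algebra k K]
    [Algebra k L] [Algebra K L] [IsScalarTower k K L] (p : ℕ) [CharP k p]
    (h : ∀ f : K, ∃ h : L, h ^ p = algebraMap K L f) :
    KaehlerDifferential.mapBaseChange k K L = 0 := by
  have : CharP L p := charP_of_injective_algebraMap (algebraMap k L).injective p
  have h0 : KaehlerDifferential.map k k K L = 0 := by
    apply LinearMap.ext_on_range (KaehlerDifferential.span_range_derivation k K)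
    intro f
    obtain ⟨g, hg⟩ := h f
    rw [KaehlerDifferential.map_D, ← hg, Derivation.leibniz_pow, ← Nat.cast_smul_eq_nsmul L,
      CharP.cast_eq_zero, zero_smul, LinearMap.zero_apply]
  refine LinearMap.ext fun y => ?_
  induction y with
  | zero => simp
  | tmul x y => rw [KaehlerDifferential.mapBaseChange_tmul, h0]; simp
  | add x y hx hy => rw [map_add, hx, hy]; simp

namespace ProjVariety

/-! ### The pull-back of rational functions -/

theorem fraction_eq_fraction_iff {k : Type u} [Field k] {σ : Type} (X : ProjVariety k σ) {d d' : ℕ}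
    {a b : homogeneousSubmodule σ k d} {a' b' : homogeneousSubmodule σ k d'}
    (hb : (b : MvPolynomial σ k) ∉ X.ideal) (hb' : (b' : MvPolynomial σ k) ∉ X.ideal) :
    X.fraction d a b hb = X.fraction d' a' b' hb' ↔
      (a * b' - a' * b : MvPolynomial σ k) ∈ X.ideal := by
  obtain ⟨i₀, h₀⟩ := X.exists_X_notMem
  have hη := X.isGenericPoint_genericCoord h₀
  have h1 : (a' * b : MvPolynomial σ k).IsHomogeneous (d + d') := by
    rw [add_comm d d']
    exact IsHomogeneous.mul a'.2 b.2
  rw [fraction_eq_div X h₀, fraction_eq_div X h₀, div_eq_div_iff, hη _ _ (IsHomogeneous.sub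
    (IsHomogeneous.mul a.2 b'.2) h1), map_sub, map_mul, map_mul, sub_eq_zero]
  · rwa [Ne, ← hη _ _ b.2]
  · rwa [Ne, ← hη _ _ b'.2]

theorem HasValueAt.eval_eq {k : Type u} [Field k] {σ : Type} {X : ProjVariety k σ} {d : ℕ}
    {a b : homogeneousSubmodule σ k d} {hb : (b : MvPolynomial σ k) ∉ X.ideal} {x : ℙ k (σ → k)}
    {c : k} (h : X.HasValueAt (X.fraction d a b hb) x c) :
    eval x.rep (a : MvPolynomial σ k) = c * eval x.rep (b : MvPolynomial σ k) := by
  obtain ⟨hx, d', a', b', hb', hab, h0, rfl⟩ := h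
  have h1 := hx _ ((X.fraction_eq_fraction_iff hb hb').1 hab)
  rw [map_sub, map_mul, map_mul, sub_eq_zero] at h1
  rw [div_mul_eq_mul_div, eq_div_iff h0, h1]

theorem HasValueAt.unique {k : Type u} [Field k] {σ : Type} {X : ProjVariety k σ}
    {f : X.FunctionField} {x : ℙ k (σ → k)} {c c' : k} (h : X.HasValueAt f x c)
    (h' : X.HasValueAt f x c') : c = c' := by
  obtain ⟨-, d, a, b, hb, rfl, h0, rfl⟩ := h
  rw [h'.eval_eq, mul_div_cancel_right₀ _ h0]

/-- The pull-back by the Gauss map is unique. -/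
theorem IsGaussPullback.unique {k : Type u} [Field k] [IsAlgClosed k] {n N : ℕ}
    {X : ProjVariety k (Fin (N + 1))} {Y : ProjVariety k (PluckerIndex n N)} {f : Y.FunctionField}
    {g g' : X.FunctionField} (hg : X.IsGaussPullback Y f g) (hg' : X.IsGaussPullback Y f g') :
    g = g' := by
  obtain ⟨e, h, hh, hhX, hg⟩ := hg
  obtain ⟨e', h', hh', hhX', hg'⟩ := hg'
  obtain ⟨d, a, b, hb, rfl⟩ := X.exists_eq_fraction g
  obtain ⟨d', a', b', hb', rfl⟩ := X.exists_eq_fraction g'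
  rw [fraction_eq_fraction_iff]
  have h1 : (a' * b : MvPolynomial (Fin (N + 1)) k).IsHomogeneous (d + d') := by
    rw [add_comm d d']
    exact IsHomogeneous.mul a'.2 b.2
  have h2 : h * h' * (a * b' - a' * b : MvPolynomial (Fin (N + 1)) k) ∈ X.ideal := by
    refine X.mem_ideal_of_forall_points (IsHomogeneous.mul (IsHomogeneous.mul hh hh')
      (IsHomogeneous.sub (IsHomogeneous.mul a.2 b'.2) h1)) fun x hx => ?_
    rw [map_mul, map_mul]
    by_cases hx1 : eval x.rep h = 0
    · rw [hx1, zero_mul, zero_mul]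
    by_cases hx2 : eval x.rep h' = 0
    · rw [hx2, mul_zero, zero_mul]
    obtain ⟨y, c, hy, hc, hgc⟩ := hg x hx hx1
    obtain ⟨y', c', hy', hc', hgc'⟩ := hg' x hx hx2
    obtain rfl := hy.2.unique hy'.2
    obtain rfl := hc.unique hc'
    rw [map_sub, map_mul, map_mul, hgc.eval_eq, hgc'.eval_eq]
    ring
  exact (X.isPrime.mem_or_mem h2).resolve_left fun h =>
    (X.isPrime.mem_or_mem h).elim hhX hhX'

/-- Infinitely many varieties have Gauss maps with image `Y`: the pull-back of a non-constant function
can be made a `p ^ e`-th power for any `e`, while on a given variety it is a `p ^ e`-th power for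
finitely many `e` only. -/
theorem infinite_setOf_zariskiClosure_gaussImage_eq {k : Type u} [Field k] [IsAlgClosed k] (p : ℕ)
    [Fact p.Prime] [CharP k p] {n N : ℕ} (Y : ProjVariety k (PluckerIndex n N))
    (hY : Y.points ⊆ grassmannian k n N) (hY1 : 1 ≤ Y.dim) (hYn : Y.dim ≤ (n : Cardinal.{u})) :
    {X : ProjVariety k (Fin (N + 1)) |
      X.dim = (n : Cardinal.{u}) ∧ zariskiClosure (X.gaussImage n) = Y.points}.Infinite := by
  have := Y.essFiniteType_functionField
  obtain ⟨f, hf⟩ : ∃ f : Y.FunctionField, Transcendental k f := by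
    have : Algebra.Transcendental k Y.FunctionField := trdeg_ne_zero_iff.1 fun h => by
      rw [dim, h] at hY1
      exact absurd hY1 (by simp)
    exact Algebra.Transcendental.transcendental
  have hex : ∀ e : ℕ, ∃ X : ProjVariety k (Fin (N + 1)), (X.dim = (n : Cardinal.{u}) ∧
      zariskiClosure (X.gaussImage n) = Y.points) ∧ ∃ g : X.FunctionField,
        X.IsGaussPullback Y f (g ^ p ^ (e + 1)) ∧ Transcendental k (g ^ p ^ (e + 1)) := by
    intro e
    obtain ⟨L, _, _, _, _, hfg, htr, hroot⟩ :=
      exists_extension_forall_exists_pow_eq (K := Y.FunctionField) p hYn (e + 1)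
    have hδ : KaehlerDifferential.mapBaseChange k Y.FunctionField L = 0 :=
      mapBaseChange_eq_zero p fun f => by
        obtain ⟨h, hh⟩ := hroot f
        exact ⟨h ^ p ^ e, by rw [← pow_mul, ← pow_succ, hh]⟩
    obtain ⟨X, hdim, hX, i, hi⟩ :=
      exists_projVariety_gaussMap p Y hY hY1 hYn L hfg htr hδ
    obtain ⟨h, hh⟩ := hroot f
    have h1 : i.symm h ^ p ^ (e + 1) = i.symm (algebraMap Y.FunctionField L f) := by
      rw [← hh, map_pow]
    refine ⟨X, ⟨hdim, hX⟩, i.symm h, ?_, ?_⟩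
    · rw [h1]
      exact hi f
    · rw [h1]
      exact (not_congr (isAlgebraic_algHom_iff (i.symm : L →ₐ[k] X.FunctionField)
        i.symm.injective)).2
        ((transcendental_algebraMap_iff (algebraMap Y.FunctionField L).injective).2 hf)
  choose X hX g hg hgtr using hex
  intro hfin
  have := hfin.to_subtype
  obtain ⟨⟨Z, hZ⟩, hZinf⟩ := Finite.exists_infinite_fiber
    fun e => (⟨X e, hX e⟩ : {X : ProjVariety k (Fin (N + 1)) |
      X.dim = (n : Cardinal.{u}) ∧ zariskiClosure (X.gaussImage n) = Y.points})
  have hZ' : ∀ e : ℕ, ∃ e' ≥ e, X e' = Z := fun e => by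
    obtain ⟨e', he', hee'⟩ := (Set.infinite_coe_iff.1 hZinf).exists_gt e
    exact ⟨e', hee'.le, congrArg Subtype.val he'⟩
  have hpull : ∀ e : ℕ, ∃ e' ≥ e, ∃ g : Z.FunctionField,
      Z.IsGaussPullback Y f (g ^ p ^ (e' + 1)) ∧ Transcendental k (g ^ p ^ (e' + 1)) := fun e => by
    obtain ⟨e', hee', rfl⟩ := hZ' e
    exact ⟨e', hee', g e', hg e', hgtr e'⟩
  obtain ⟨e₀, -, g₀, hg₀, htr₀⟩ := hpull 0
  have := Z.essFiniteType_functionField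
  refine htr₀ (isAlgebraic_of_forall_exists_pow_eq p fun e => ?_)
  obtain ⟨e', hee', g', hg', -⟩ := hpull e
  refine ⟨g' ^ p ^ (e' + 1 - e), ?_⟩
  rw [hg₀.unique hg', ← pow_mul, ← pow_add, Nat.sub_add_cancel (by omega)]

end ProjVariety

theorem theorem1p1 {k : Type u} [Field k] [IsAlgClosed k] (p : ℕ) [CharP k p] (hp : 0 < p)
    (n N : ℕ) (Y : ProjVariety k (PluckerIndex n N)) (hY : Y.points ⊆ grassmannian k n N)
    (hY1 : 1 ≤ Y.dim) (hYn : Y.dim ≤ (n : Cardinal.{u})) :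
    (∀ (L : Type v) [Field L] [Algebra k L] [Algebra Y.FunctionField L]
        [IsScalarTower k Y.FunctionField L],
      (⊤ : IntermediateField k L).FG →
      Algebra.trdeg k L = (n : Cardinal.{v}) →
      KaehlerDifferential.mapBaseChange k Y.FunctionField L = 0 →
      ∃ X : ProjVariety k (Fin (N + 1)),
        X.dim = (n : Cardinal.{u}) ∧
        zariskiClosure (X.gaussImage n) = Y.points ∧
        ∃ e : X.FunctionField ≃ₐ[k] L, ∀ f : Y.FunctionField,
          X.IsGaussPullback Y f (e.symm (algebraMap Y.FunctionField L f))) ∧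
    {X : ProjVariety k (Fin (N + 1)) |
      X.dim = (n : Cardinal.{u}) ∧
      zariskiClosure (X.gaussImage n) = Y.points}.Infinite := by
  have : Fact p.Prime := ⟨(CharP.char_is_prime_or_zero k p).resolve_right hp.ne'⟩
  exact ⟨fun L _ _ _ _ hL hLn hδ => Y.exists_projVariety_gaussMap p hY hY1 hYn L hL hLn hδ,
    Y.infinite_setOf_zariskiClosure_gaussImage_eq p hY hY1 hYn⟩
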